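/- Let $n\ge 1$. A path $\boldsymbol J$ on $n$ qubits is a sequence of spins $j_1=\tfrac12, j_2,\dots,j_n=J$ with $j_{i+1}=j_i\pm\tfrac12$ and all $j_i\ge 0$, and $M\in\{-J,-J+1,\dots,J\}$. Let $|\boldsymbol J,M\rangle$ be the corresponding sequentially coupled basis state, obtained by coupling one qubit at a time with the (Condon–Shortley) Clebsch–Gordan coefficients, $$|j_1,\dots,j_{i+1};m\rangle=\sum_{\sigma=\pm 1/2}C^{\,j_{i+1},m}_{\,j_i,m-\sigma;\,\frac12,\sigma}\;|j_1,\dots,j_i;m-\sigma\rangle\otimes|\sigma\rangle ,\qquad |0\rangle=|{+\tfrac12}\rangle,\ |1\rangle=|{-\tfrac12}\rangle .$$ Let $w:\{0,1\}^n\to\{0,1\}^n$ be the function computed by a sequence $C$ of Toffoli gates, and let $W|x\rangle=|w(x)\rangle$. A family of states, each given by a classical description of length polynomial in its number $n$ of qubits, is called computationally tractable (CT) if there are classical algorithms which, given $n$, the description of a state $|\phi\rangle$ of the family and a precision parameter $p\in\mathbb N$, run in time polynomial in $n$ and $p$ and (a) for every given $x\in\{0,1\}^n$ compute $\langle x|\phi\rangle$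 up to an error of at most $2^{-p}$; (b) using polynomially many fair random bits, output a sample from the distribution $x\mapsto|\langle x|\phi\rangle|^2$ up to $2^{-p}$ in total variation distance. Then, for every polynomial $q$, the states $W|\boldsymbol J,M\rangle$ are CT, where $n\ge1$, $(\boldsymbol J,M)$ is an arbitrary label of a sequentially coupled basis state on $n$ qubits and $W$ is an arbitrary circuit of at most $q(n)$ Toffoli gates; the state is described by the path, $M$ and the list of gates. Moreover, for all such $n$, $(\boldsymbol J,M)$ and every Toffoli circuit $C$, the function $w$ is a bijection whose inverse is computed by the gates of $C$ in reverse order, $\langle y|W|\boldsymbol J,M\rangle=\langle w^{-1}(y)|\boldsymbol J,M\rangle$ for all $y$, and the distribution $|\langle y|W|\boldsymbol J,M\rangle|^2$ is the image under $w$ of the distribution $|\langle x|\boldsymbol J,M\rangle|^2$. -/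

import Mathlib

open scoped BigOperators

/-! ### Machine model: random access machines with logarithmic cost -/

/-- The arithmetic instructions (subtraction and division are those of `ℕ`). -/
inductive ArithOp
  | add | sub | mul | div

def ArithOp.eval : ArithOp → ℕ → ℕ → ℕ
  | .add, a, b => a + b
  | .sub, a, b => a - b
  | .mul, a, b => a * b
  | .div, a, b => a / b

/-- A store of a random access machine: registers, addressed directly by the program,
and a memory, addressed indirectly through the registers. -/
structure Store where
  reg : ℕ → ℕ
  mem : ℕ → ℕ

def Store.setReg (s : Store) (d v : ℕ) : Store :=
  { s with reg := Function.update s.reg d v }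

def Store.setMem (s : Store) (d v : ℕ) : Store :=
  { s with mem := Function.update s.mem d v }

/-- Structured programs of a random access machine. -/
inductive Prog
  /-- do nothing -/
  | skip
  /-- `reg d := v` -/
  | const (d v : ℕ)
  /-- `reg d := reg a ∘ reg b` -/
  | arith (o : ArithOp) (d a b : ℕ)
  /-- `reg d := mem (reg a)` -/
  | load (d a : ℕ)
  /-- `mem (reg d) := reg a` -/
  | store (d a : ℕ)
  | seq (P Q : Prog)
  /-- if `reg a ≠ 0` then `P` else `Q` -/
  | ite (a : ℕ) (P Q : Prog)
  /-- while `reg a ≠ 0` do `P` -/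
  | loop (a : ℕ) (P : Prog)

/-- The logarithmic cost of handling the number `v`: its number of binary digits, plus one. -/
def logCost (v : ℕ) : ℕ := Nat.size v + 1

/-- `Exec P s s' t`: the program `P`, started in the store `s`, halts in the store `s'`, and the
total logarithmic cost of the instructions and tests that it has executed is `t`. -/
inductive Exec : Prog → Store → Store → ℕ → Prop
  | skip (s : Store) : Exec .skip s s 1
  | const (s : Store) (d v : ℕ) : Exec (.const d v) s (s.setReg d v) (logCost v)
  | arith (s : Store) (o : ArithOp) (d a b : ℕ) :
      Exec (.arith o d a b) s (s.setReg d (o.eval (s.reg a) (s.reg b)))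
        (logCost (s.reg a) + logCost (s.reg b))
  | load (s : Store) (d a : ℕ) :
      Exec (.load d a) s (s.setReg d (s.mem (s.reg a)))
        (logCost (s.reg a) + logCost (s.mem (s.reg a)))
  | store (s : Store) (d a : ℕ) :
      Exec (.store d a) s (s.setMem (s.reg d) (s.reg a))
        (logCost (s.reg d) + logCost (s.reg a))
  | seq {P Q : Prog} {s s' s'' : Store} {t t' : ℕ} :
      Exec P s s' t → Exec Q s' s'' t' → Exec (.seq P Q) s s'' (t + t')
  | ite_true {a : ℕ} {P Q : Prog} {s s' : Store} {t : ℕ} :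
      s.reg a ≠ 0 → Exec P s s' t → Exec (.ite a P Q) s s' (logCost (s.reg a) + t)
  | ite_false {a : ℕ} {P Q : Prog} {s s' : Store} {t : ℕ} :
      s.reg a = 0 → Exec Q s s' t → Exec (.ite a P Q) s s' (logCost (s.reg a) + t)
  | loop_true {a : ℕ} {P : Prog} {s s' s'' : Store} {t t' : ℕ} :
      s.reg a ≠ 0 → Exec P s s' t → Exec (.loop a P) s' s'' t' →
        Exec (.loop a P) s s'' (logCost (s.reg a) + t + t')
  | loop_false {a : ℕ} {P : Prog} {s : Store} :
      s.reg a = 0 → Exec (.loop a P) s s (logCost (s.reg a))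

/-- The initial store on input `n` (number of qubits), `p` (precision), a bit string
(an argument, or the random bits) and a description `d`: registers `0, 1, 2` hold `n`, `p` and the
length of the bit string, the memory holds the bit string followed by `d`, and everything else
is `0`. -/
def initialStore (n p : ℕ) {k : ℕ} (bits : Fin k → Bool) (d : List ℕ) : Store where
  reg i := [n, p, k].getD i 0
  mem i := ((List.ofFn fun j => (bits j).toNat) ++ d).getD i 0

/-- The complex number with rational real and imaginary part that a halting program returns
in its registers `0, …, 4`. -/
noncomputable def Store.outComplex (s : Store) : ℂ :=
  (((s.reg 0 : ℂ) - (s.reg 1 : ℂ)) + ((s.reg 2 : ℂ) - (s.reg 3 : ℂ)) * Complex.I) / (s.reg 4 : ℂ)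

/-- The `n`-bit string that a halting program returns in its first `n` memory cells. -/
def Store.outBits (s : Store) (n : ℕ) : Fin n → Bool :=
  fun i => decide (s.mem i ≠ 0)

/-! ### Computationally tractable states -/

/-- Vectors of the `n`-qubit space, through their coefficients `⟨x|ψ⟩` in the computational basis;
`false` is `|0⟩` and `true` is `|1⟩`. -/
abbrev QState (n : ℕ) : Type := (Fin n → Bool) → ℂ

section CT

variable {ι : Type} (n : ι → ℕ) (desc : ι → List ℕ) (ψ : ∀ i, QState (n i))

/-- The classical descriptions have a number of bits that is polynomial in the number of qubits. -/
def PolySizeDescriptions : Prop :=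
  ∃ B : Polynomial ℕ, ∀ i, ((desc i).map logCost).sum ≤ B.eval (n i)

/-- Some algorithm computes the overlaps `⟨x|ψ i⟩` to precision `2 ^ (-p)` in time
polynomial in the number of qubits and in `p`. -/
def AmplitudesPolyTime : Prop :=
  ∃ (P : Prog) (T : Polynomial ℕ), ∀ (i : ι) (p : ℕ) (x : Fin (n i) → Bool),
    ∃ (s : Store) (t : ℕ),
      Exec P (initialStore (n i) p x (desc i)) s t ∧ t ≤ T.eval (n i + p) ∧
      0 < s.reg 4 ∧ ‖s.outComplex - ψ i x‖ ≤ (2 ^ p : ℝ)⁻¹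

/-- Some randomized algorithm, using polynomially many fair random bits and running in time
polynomial in the number of qubits and in `p`, samples from the distribution `|⟨x|ψ i⟩|²` up to
`2 ^ (-p)` in total variation distance. -/
def SamplesPolyTime : Prop :=
  ∃ (P : Prog) (T R : Polynomial ℕ), ∀ (i : ι) (p : ℕ),
    ∃ out : (Fin (R.eval (n i + p)) → Bool) → (Fin (n i) → Bool),
      (∀ r, ∃ (s : Store) (t : ℕ),
        Exec P (initialStore (n i) p r (desc i)) s t ∧ t ≤ T.eval (n i + p) ∧
        s.outBits (n i) = out r) ∧
      (1 / 2 : ℝ) * ∑ x : Fin (n i) → Bool,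
          |((Finset.univ.filter fun r => out r = x).card : ℝ) / 2 ^ (R.eval (n i + p))
            - ‖ψ i x‖ ^ 2| ≤ (2 ^ p : ℝ)⁻¹

/-- The family of states `ψ i` on `n i` qubits, given by the classical descriptions `desc i`, is
computationally tractable. The algorithms receive the description as an input, so one algorithm
serves all states of the family. -/
def ComputationallyTractable : Prop :=
  PolySizeDescriptions n desc ∧ AmplitudesPolyTime n desc ψ ∧ SamplesPolyTime n desc ψ

end CT

/-! ### The sequentially coupled basis -/

/-- `SpinPath n a`: the paths `j₁ = 1/2 → j₂ → ⋯ → jₙ = J` in the branching diagram with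
`2 * J = a`; each step goes up or down by `1/2` and the spin never becomes negative. -/
inductive SpinPath : ℕ → ℕ → Type
  | one : SpinPath 1 1
  | up {n a : ℕ} : SpinPath n a → SpinPath (n + 1) (a + 1)
  | down {n a : ℕ} : SpinPath n (a + 1) → SpinPath (n + 1) a

/-- The steps of a path in order (its Yamanouchi symbol), `1` for up and `0` for down. -/
def SpinPath.steps : {n a : ℕ} → SpinPath n a → List ℕ
  | _, _, .one => []
  | _, _, .up P => P.steps ++ [1]
  | _, _, .down P => P.steps ++ [0]

/-- Twice the azimuthal spin of a single qubit: `+1` for `|0⟩` and `-1` for `|1⟩`. -/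
def twoSpin (b : Bool) : ℤ := if b then -1 else 1

/-- The Clebsch–Gordan coefficient `C^{j+1/2, M}_{j, M-σ; 1/2, σ}` with `σ = 1/2` for
`b = false` and `σ = -1/2` for `b = true`. -/
noncomputable def clebschUp (j M : ℝ) (b : Bool) : ℝ :=
  if b then √((j - M + 1 / 2) / (2 * j + 1)) else √((j + M + 1 / 2) / (2 * j + 1))

/-- The Clebsch–Gordan coefficient `C^{j-1/2, M}_{j, M-σ; 1/2, σ}` with `σ = 1/2` for
`b = false` and `σ = -1/2` for `b = true`. -/
noncomputable def clebschDown (j M : ℝ) (b : Bool) : ℝ :=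
  if b then √((j + M + 1 / 2) / (2 * j + 1)) else -√((j - M + 1 / 2) / (2 * j + 1))

/-- The sequentially coupled basis state `|J, M⟩` with `M = m / 2`, obtained by coupling one qubit
at a time. Only `m ∈ {-a, -a + 2, …, a}` is meaningful. -/
noncomputable def SpinPath.state : {n a : ℕ} → SpinPath n a → ℤ → QState n
  | _, _, .one, m => fun x => if m = twoSpin (x 0) then 1 else 0
  | _, _, .up (n := n) (a := a) P, m => fun x =>
      (clebschUp ((a : ℝ) / 2) ((m : ℝ) / 2) (x (Fin.last n)) : ℂ) *
        P.state (m - twoSpin (x (Fin.last n))) (Fin.init x)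
  | _, _, .down (n := n) (a := a) P, m => fun x =>
      (clebschDown (((a + 1 : ℕ) : ℝ) / 2) ((m : ℝ) / 2) (x (Fin.last n)) : ℂ) *
        P.state (m - twoSpin (x (Fin.last n))) (Fin.init x)

/-- The basis state `|J, M⟩` with `M = -J + k`, for `k = 0, 1, …, 2J`. -/
noncomputable def SpinPath.basisState {n a : ℕ} (P : SpinPath n a) (k : Fin (a + 1)) : QState n :=
  P.state (2 * (k : ℤ) - (a : ℤ))

/-! ### Toffoli circuits -/

/-- A Toffoli gate on `n` wires. -/
structure Toffoli (n : ℕ) where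
  control₁ : Fin n
  control₂ : Fin n
  target : Fin n
  control_ne : control₁ ≠ control₂
  target_ne₁ : control₁ ≠ target
  target_ne₂ : control₂ ≠ target

def Toffoli.apply {n : ℕ} (g : Toffoli n) (x : Fin n → Bool) : Fin n → Bool :=
  Function.update x g.target (xor (x g.target) (x g.control₁ && x g.control₂))

def Toffoli.code {n : ℕ} (g : Toffoli n) : List ℕ := [g.control₁, g.control₂, g.target]

/-- The function `w` computed by a sequence of Toffoli gates, the first gate being applied first. -/
def circuitFun {n : ℕ} (C : List (Toffoli n)) (x : Fin n → Bool) : Fin n → Bool :=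
  C.foldl (fun y g => g.apply y) x

/-- The matrix, in the computational basis, of the operator `W |x⟩ = |w x⟩`. -/
def circuitOp {n : ℕ} (C : List (Toffoli n)) :
    Matrix (Fin n → Bool) (Fin n → Bool) ℂ :=
  Matrix.of fun y x => if circuitFun C x = y then 1 else 0

/-- A state `W |J, M⟩`: a path, the number `k = J + M`, and a circuit of at most `q n` gates. -/
structure SchurData (q : Polynomial ℕ) where
  n : ℕ
  twoJ : ℕ
  path : SpinPath n twoJ
  k : Fin (twoJ + 1)
  circuit : List (Toffoli n)
  length_le : circuit.length ≤ q.eval n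

/-- The description of `W |J, M⟩`: the number `J + M`, the number of gates, the steps of the path
and the wires of the gates. -/
def SchurData.desc {q : Polynomial ℕ} (D : SchurData q) : List ℕ :=
  [(D.k : ℕ), D.circuit.length] ++ D.path.steps ++ D.circuit.flatMap Toffoli.code

/-- The state `W |J, M⟩`. -/
noncomputable def SchurData.state {q : Polynomial ℕ} (D : SchurData q) : QState D.n :=
  (circuitOp D.circuit).mulVec (D.path.basisState D.k)

/-! Write `a = 2J` and `M = -J + k`. Once the last qubit is fixed, the magnetic number at the
previous level is determined, so the coupling recursion does not branch: an amplitude is a product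
of `n - 1` Clebsch–Gordan coefficients, each of them plus or minus the root of a rational number
with denominator at most `n`. It therefore equals `(-1)^g √(N/D)` with `D ≤ n^(n-1)`. The integers
`g`, `N`, `D` are found exactly by walking along the path from the first qubit, whose value fixes
the initial `k`; the amplitude is zero unless the walk ends at the prescribed `k` (`walk_spec`). The
root is then extracted one binary digit at a time (`sqrtDigits_spec`).

The squared coefficients are conditional probabilities: given `k`, the last bit is 0 with a rational
probability `u/v`, and what remains is a basis state on one qubit less. Sampling thus goes from the
last qubit to the first and can be driven by one uniform number in `[0, 1)`: compare it with `u/v`,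
keep the part of the unit interval that contains it, and stretch that part to `[0, 1)` again. Each
string owns a half-open interval whose length is its probability (`SpinPath.isSubinterval_sample`).
Such an interval contains the expected number of multiples of `2^(-K)` up to an error of 1, so `K =
n + p` random bits compensate for the `2^n` outcomes.

A Toffoli gate is an involution, hence `W` permutes the computational basis: amplitudes are read at
the string obtained by running the gates backwards, and samples are sent through the gates forwards.

For the running time, a loop-free program multiplies the number of bits by a constant and has
constant cost per bit (`Prog.runs_eval`). Loop bodies are evaluated symbolically, and the stores
between rounds are all bounded by one number of bits `B`, quadratic in `n` and linear in `p` and the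
number of gates. Summing over the rounds (`runs_loop`, or `Runs.loop_step` in an induction) gives a
polynomial. -/

/-! ### Executing loop-free programs -/

/-- The effect of a program without loops. -/
def Prog.eval : Prog → Store → Store
  | .skip, s => s
  | .const d v, s => s.setReg d v
  | .arith o d a b, s => s.setReg d (o.eval (s.reg a) (s.reg b))
  | .load d a, s => s.setReg d (s.mem (s.reg a))
  | .store d a, s => s.setMem (s.reg d) (s.reg a)
  | .seq P Q, s => Q.eval (P.eval s)
  | .ite a P Q, s => if s.reg a = 0 then Q.eval s else P.eval s
  | .loop _ _, s => s

def Prog.loopFree : Prog → Bool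
  | .seq P Q => P.loopFree && Q.loopFree
  | .ite _ P Q => P.loopFree && Q.loopFree
  | .loop _ _ => false
  | _ => true

/-- The factor by which a loop-free program can increase the number of bits of the values. -/
def Prog.growth : Prog → ℕ
  | .const _ v => v.size + 1
  | .arith _ _ _ _ => 2
  | .seq P Q => Q.growth * P.growth
  | .ite _ P Q => P.growth + Q.growth
  | _ => 1

/-- The cost per bit of a loop-free program. -/
def Prog.costFactor : Prog → ℕ
  | .const _ v => v.size + 1
  | .seq P Q => P.costFactor + Q.costFactor * P.growth
  | .ite _ P Q => 2 + P.costFactor + Q.costFactor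
  | _ => 4

/-- All values in the store have at most `B` bits. -/
structure Store.Bounded (B : ℕ) (s : Store) : Prop where
  reg : ∀ i, s.reg i < 2 ^ B
  mem : ∀ i, s.mem i < 2 ^ B

/-- `P` takes the store `s` to `s'` at cost at most `T`. -/
def Runs (P : Prog) (s s' : Store) (T : ℕ) : Prop := ∃ t ≤ T, Exec P s s' t

theorem Runs.mono {P : Prog} {s s' : Store} {T T' : ℕ} (h : Runs P s s' T) (hT : T ≤ T') :
    Runs P s s' T' := by
  obtain ⟨t, ht, he⟩ := h
  exact ⟨t, ht.trans hT, he⟩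

theorem Runs.seq {P Q : Prog} {s s' s'' : Store} {T T' : ℕ} (h : Runs P s s' T)
    (h' : Runs Q s' s'' T') : Runs (.seq P Q) s s'' (T + T') := by
  obtain ⟨t, ht, he⟩ := h
  obtain ⟨t', ht', he'⟩ := h'
  exact ⟨t + t', add_le_add ht ht', .seq he he'⟩

theorem Store.Bounded.mono {B B' : ℕ} {s : Store} (h : s.Bounded B) (hB : B ≤ B') :
    s.Bounded B' :=
  ⟨fun i => (h.reg i).trans_le (Nat.pow_le_pow_right two_pos hB),
    fun i => (h.mem i).trans_le (Nat.pow_le_pow_right two_pos hB)⟩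

theorem Store.Bounded.setReg {B : ℕ} {s : Store} (h : s.Bounded B) {d v : ℕ} (hv : v < 2 ^ B) :
    (s.setReg d v).Bounded B := by
  refine ⟨fun i => ?_, h.mem⟩
  by_cases hi : i = d
  · subst hi; simpa [Store.setReg] using hv
  · simpa [Store.setReg, hi] using h.reg i

theorem Store.Bounded.setMem {B : ℕ} {s : Store} (h : s.Bounded B) {d v : ℕ} (hv : v < 2 ^ B) :
    (s.setMem d v).Bounded B := by
  refine ⟨h.reg, fun i => ?_⟩
  by_cases hi : i = d
  · subst hi; simpa [Store.setMem] using hv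
  · simpa [Store.setMem, hi] using h.mem i

theorem ArithOp.eval_lt {B : ℕ} (hB : 1 ≤ B) (o : ArithOp) {a b : ℕ} (ha : a < 2 ^ B)
    (hb : b < 2 ^ B) : o.eval a b < 2 ^ (2 * B) := by
  have h2 : 2 ≤ 2 ^ B := by simpa using Nat.pow_le_pow_right two_pos hB
  have h : 2 ^ (2 * B) = 2 ^ B * 2 ^ B := by rw [two_mul, pow_add]
  rw [h]
  cases o
  · simp only [ArithOp.eval]; nlinarith
  · simp only [ArithOp.eval]; exact (Nat.sub_le _ _).trans_lt (by nlinarith)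
  · exact Nat.mul_lt_mul'' ha hb
  · exact (Nat.div_le_self _ _).trans_lt (by nlinarith)

theorem Prog.one_le_growth : ∀ P : Prog, 1 ≤ P.growth
  | .skip | .load _ _ | .store _ _ | .loop _ _ => le_rfl
  | .const _ _ => Nat.le_add_left 1 _
  | .arith _ _ _ _ => one_le_two
  | .seq P Q => Nat.mul_pos Q.one_le_growth P.one_le_growth
  | .ite _ P _ => Nat.le_add_right_of_le P.one_le_growth

/-- The assumption `1 ≤ B` lets the fixed size of a constant be absorbed into a factor, so that
growth is purely multiplicative and composes under `seq`. -/
theorem Prog.eval_bounded {B : ℕ} (hB : 1 ≤ B) : ∀ (P : Prog) (s : Store), s.Bounded B →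
    (P.eval s).Bounded (P.growth * B) := by
  intro P
  induction P generalizing B with
  | skip => intro s h; simpa [eval, growth] using h
  | const d v =>
    intro s h
    have h1 : v.size * 1 ≤ v.size * B := Nat.mul_le_mul_left _ hB
    refine (h.mono (by simp only [growth]; nlinarith)).setReg ?_
    refine (Nat.lt_size_self v).trans_le (Nat.pow_le_pow_right two_pos ?_)
    simp only [growth]; nlinarith
  | arith o d a b =>
    intro s h
    exact (h.mono (by simp only [growth]; omega)).setReg (o.eval_lt hB (h.reg a) (h.reg b))
  | load d a => intro s h; simpa [growth, eval] using h.setReg (h.mem _)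
  | store d a => intro s h; simpa [growth, eval] using h.setMem (h.reg _)
  | seq P Q ihP ihQ =>
    intro s h
    have := ihQ (Nat.mul_pos P.one_le_growth hB) _ (ihP hB s h)
    simpa only [growth, eval, mul_assoc] using this
  | ite a P Q ihP ihQ =>
    intro s h
    simp only [eval, growth, add_mul]
    split
    · exact (ihQ hB s h).mono (Nat.le_add_left _ _)
    · exact (ihP hB s h).mono (Nat.le_add_right _ _)
  | loop => intro s h; simpa [eval, growth] using h

theorem logCost_le {B v : ℕ} (h : v < 2 ^ B) : logCost v ≤ B + 1 :=
  Nat.succ_le_succ (Nat.size_le.2 h)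

/-- Handling a value costs at most `B + 1 ≤ 2 * B`, and an instruction handles at most two. In a
sequence the second program starts from values of `P.growth * B` bits, which is why that factor
enters the cost. -/
theorem Prog.runs_eval {B : ℕ} (hB : 1 ≤ B) : ∀ (P : Prog) (s : Store), P.loopFree = true →
    s.Bounded B → Runs P s (P.eval s) (P.costFactor * B) := by
  intro P
  induction P generalizing B with
  | skip => intro s _ _; exact ⟨1, by simp only [costFactor]; omega, .skip s⟩
  | const d v =>
    intro s _ _
    exact ⟨_, by simpa [costFactor, logCost] using Nat.mul_le_mul_left (v.size + 1) hB, .const s d v⟩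
  | arith o d a b =>
    intro s _ h
    have h1 := logCost_le (h.reg a)
    have h2 := logCost_le (h.reg b)
    exact ⟨_, by simp only [costFactor]; omega, .arith s o d a b⟩
  | load d a =>
    intro s _ h
    have h1 := logCost_le (h.reg a)
    have h2 := logCost_le (h.mem (s.reg a))
    exact ⟨_, by simp only [costFactor]; omega, .load s d a⟩
  | store d a =>
    intro s _ h
    have h1 := logCost_le (h.reg d)
    have h2 := logCost_le (h.reg a)
    exact ⟨_, by simp only [costFactor]; omega, .store s d a⟩
  | seq P Q ihP ihQ =>
    intro s hl h
    simp only [loopFree, Bool.and_eq_true] at hl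
    have h1 := ihP hB s hl.1 h
    have h2 := ihQ (Nat.mul_pos P.one_le_growth hB) _ hl.2 (P.eval_bounded hB s h)
    exact (h1.seq h2).mono (by simp only [costFactor, add_mul, mul_assoc, le_refl])
  | ite a P Q ihP ihQ =>
    intro s hl h
    simp only [loopFree, Bool.and_eq_true] at hl
    have h0 := logCost_le (h.reg a)
    simp only [eval, costFactor, add_mul]
    split
    · next ha =>
      obtain ⟨t, ht, he⟩ := ihQ hB s hl.2 h
      exact ⟨_, by omega, .ite_false ha he⟩
    · next ha =>
      obtain ⟨t, ht, he⟩ := ihP hB s hl.1 h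
      exact ⟨_, by omega, .ite_true ha he⟩
  | loop => intro s hl; simp [loopFree] at hl

theorem runs_loop_zero {a B : ℕ} {P : Prog} {s : Store} (h : s.Bounded B) (h0 : s.reg a = 0) :
    Runs (.loop a P) s s (B + 1) :=
  ⟨_, logCost_le (h.reg a), .loop_false h0⟩

theorem Runs.loop_step {a B T T' : ℕ} {P : Prog} {s s' s'' : Store} (h : s.Bounded B)
    (ha : s.reg a ≠ 0) (h1 : Runs P s s' T) (h2 : Runs (.loop a P) s' s'' T') :
    Runs (.loop a P) s s'' (B + 1 + T + T') := by
  obtain ⟨t, ht, he⟩ := h1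
  obtain ⟨t', ht', he'⟩ := h2
  have := logCost_le (h.reg a)
  exact ⟨_, by omega, .loop_true ha he he'⟩

/-- The cost factor of `N` rounds of a loop with body `P`. -/
def loopFactor (P : Prog) (N : ℕ) : ℕ := (N + 1) * (P.costFactor + 2)

theorem loopFactor_zero {B : ℕ} (hB : 1 ≤ B) (P : Prog) : B + 1 ≤ loopFactor P 0 * B := by
  unfold loopFactor; nlinarith

theorem loopFactor_succ {B : ℕ} (hB : 1 ≤ B) (P : Prog) (N : ℕ) :
    B + 1 + P.costFactor * B + loopFactor P N * B ≤ loopFactor P (N + 1) * B := by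
  unfold loopFactor; nlinarith

/-- A loop whose successive stores are `S 0, …, S N`. -/
theorem runs_loop {a B : ℕ} (hB : 1 ≤ B) {P : Prog} (hP : P.loopFree = true) (N : ℕ)
    (S : ℕ → Store) (hS : ∀ i ≤ N, (S i).Bounded B) (hstep : ∀ i < N, P.eval (S i) = S (i + 1))
    (hne : ∀ i < N, (S i).reg a ≠ 0) (h0 : (S N).reg a = 0) :
    Runs (.loop a P) (S 0) (S N) (loopFactor P N * B) := by
  -- The bound `B` is assumed for the store before every round; iterating `Prog.eval_bounded`
  -- instead would multiply it by the growth factor each time and become exponential in `N`.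
  induction N generalizing S with
  | zero => exact (runs_loop_zero (hS 0 le_rfl) h0).mono (loopFactor_zero hB P)
  | succ N ih =>
    have h1 := P.runs_eval hB _ hP (hS 0 (Nat.zero_le _))
    rw [hstep 0 (Nat.succ_pos _)] at h1
    have h2 := ih (fun i => S (i + 1)) (fun i hi => hS _ (by omega)) (fun i hi => hstep _ (by omega))
      (fun i hi => hne _ (by omega)) h0
    exact (Runs.loop_step (hS 0 (Nat.zero_le _)) (hne 0 (Nat.succ_pos _)) h1 h2).mono
      (loopFactor_succ hB P N)

/-! ### Stores given by a list of registers -/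

/-- The store with registers `l` and memory `m`. -/
def storeOf (l : List ℕ) (m : ℕ → ℕ) : Store := ⟨fun i => l.getD i 0, m⟩

@[simp] theorem storeOf_reg (l : List ℕ) (m : ℕ → ℕ) (i : ℕ) :
    (storeOf l m).reg i = l.getD i 0 := rfl

@[simp] theorem storeOf_mem (l : List ℕ) (m : ℕ → ℕ) : (storeOf l m).mem = m := rfl

theorem storeOf_setReg {l : List ℕ} {d : ℕ} (hd : d < l.length) (m : ℕ → ℕ) (v : ℕ) :
    (storeOf l m).setReg d v = storeOf (l.set d v) m := by
  simp only [storeOf, Store.setReg, Store.mk.injEq, and_true]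
  funext i
  by_cases hi : i = d
  · subst hi; simp [List.getD, hd]
  · simp [List.getD, hi, List.getElem?_set_ne (Ne.symm hi)]

@[simp] theorem storeOf_setMem (l : List ℕ) (m : ℕ → ℕ) (d v : ℕ) :
    (storeOf l m).setMem d v = storeOf l (Function.update m d v) := rfl

theorem storeOf_bounded {B : ℕ} {l : List ℕ} {m : ℕ → ℕ} (hl : ∀ v ∈ l, v < 2 ^ B)
    (hm : ∀ i, m i < 2 ^ B) : (storeOf l m).Bounded B := by
  refine ⟨fun i => ?_, hm⟩
  simp only [storeOf_reg, List.getD]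
  rcases h : l[i]? with _ | v
  · simp
  · exact hl v (List.mem_of_getElem? h)

/-- The sequential composition of a list of programs. -/
def Prog.block : List Prog → Prog
  | [] => .skip
  | [P] => P
  | P :: Q :: l => .seq P (block (Q :: l))

/-! ### The programs

Registers `0, 1, 2` keep the input, register `3` counts rounds, register `4` points to the
description, registers `5` to `9` and `18` are scratch and registers `15, 16, 17` hold the
constants `1, 2, 3`. -/

/-- Set up the constants. -/
def constProg : Prog := .block [.const 15 1, .const 16 2, .const 17 3]

/-- Apply the gate whose description register `4` points to. -/
def gateProg : Prog := .block
  [.load 5 4, .load 5 5, .arith .add 6 4 15, .load 7 6, .load 7 7, .arith .mul 5 5 7,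
    .arith .add 6 6 15, .load 6 6, .load 7 6, .arith .mul 8 5 7, .arith .mul 8 8 16,
    .arith .add 7 7 5, .arith .sub 7 7 8, .store 6 7,
    .const 5 0, .const 6 0, .const 7 0, .const 8 0]

/-- Point to the end of the list of gates and count them. -/
def gatesEndProg : Prog := .block
  [.arith .add 5 2 15, .load 3 5, .arith .add 4 2 0, .arith .add 4 4 15, .arith .mul 5 3 17,
    .arith .add 4 4 5, .const 5 0]

def gateBackwardBody : Prog := .block [.arith .sub 4 4 17, gateProg, .arith .sub 3 3 15]

def gateForwardBody : Prog := .block [gateProg, .arith .add 4 4 17, .arith .sub 3 3 15]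

/-- Prepare the walk along the path: twice the spin `a` in register `10`, `k` in register `11`,
the squared amplitude in registers `12` (numerator) and `13` (denominator), the sign in register
`14`. -/
def walkInitProg : Prog := .block
  [.load 5 5, .arith .sub 11 15 5, .const 10 1, .const 12 1, .const 13 1, .const 14 0,
    .arith .sub 3 0 15, .arith .add 4 2 16, .const 9 1, .const 5 0]

def walkBody : Prog := .block
  [.load 5 4, .load 6 9, .arith .add 7 10 15, .arith .mul 13 13 7,
    .ite 5
      (.block [
        .ite 6
          (.block [.arith .sub 7 7 11, .arith .mul 12 12 7])
          (.block [.arith .add 11 11 15, .arith .mul 12 12 11]),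
        .arith .add 10 10 15])
      (.block [
        .ite 6
          (.block [.arith .mul 12 12 11, .arith .sub 11 11 15])
          (.block [.arith .sub 7 10 11, .arith .mul 12 12 7, .arith .sub 14 15 14]),
        .arith .sub 10 10 15]),
    .const 5 0, .const 6 0, .const 7 0,
    .arith .add 4 4 15, .arith .add 9 9 15, .arith .sub 3 3 15]

/-- Compare `k` with its prescribed value and prepare the square root: its approximation in
register `10`, the denominator of the approximation in register `11`. -/
def sqrtInitProg : Prog := .block
  [.load 5 2, .arith .sub 6 5 11, .arith .sub 7 11 5, .arith .add 6 6 7,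
    .ite 6 (.const 12 0) .skip, .const 5 0, .const 6 0, .const 7 0,
    .arith .div 10 12 13, .const 11 1, .arith .add 3 1 5]

def sqrtBody : Prog := .block
  [.arith .add 10 10 10, .arith .add 11 11 11, .arith .mul 12 12 16, .arith .mul 12 12 16,
    .arith .add 5 10 15, .arith .mul 6 5 5, .arith .mul 6 6 13, .arith .add 7 12 15,
    .arith .sub 7 7 6, .ite 7 (.arith .add 10 10 15) .skip,
    .const 5 0, .const 6 0, .const 7 0, .arith .sub 3 3 15]

def outputProg : Prog := .block
  [.ite 14 (.block [.arith .add 1 10 5, .const 0 0]) (.block [.arith .add 0 10 5, .const 1 0]),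
    .const 2 0, .const 3 0, .arith .add 4 11 5]

def amplitudeProg : Prog := .block
  [.block [constProg, gatesEndProg], .loop 3 gateBackwardBody,
    walkInitProg, .loop 3 walkBody, sqrtInitProg, .loop 3 sqrtBody, outputProg]

/-- Prepare the conversion of the random bits to a number in register `12`. -/
def bitsInitProg : Prog := .block [constProg, .const 13 1, .arith .add 3 2 14]

def bitsBody : Prog := .block
  [.load 5 4, .arith .mul 5 5 13, .arith .add 12 12 5, .arith .add 13 13 13,
    .arith .add 4 4 15, .arith .sub 3 3 15, .const 5 0]

/-- Prepare the computation of twice the final spin in register `10`. -/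
def spinInitProg : Prog := .block [.const 10 1, .arith .sub 3 0 15, .arith .add 4 2 16]

def spinBody : Prog := .block
  [.load 5 4, .ite 5 (.arith .add 10 10 15) (.arith .sub 10 10 15), .const 5 0,
    .arith .add 4 4 15, .arith .sub 3 3 15]

def sampleInitProg : Prog := .block [.load 11 2, .arith .sub 3 0 15]

def sampleBody : Prog := .block
  [.arith .sub 4 4 15, .load 5 4,
    .ite 5
      (.block [.arith .add 6 10 14, .arith .add 7 11 14])
      (.block [.arith .add 6 10 16, .arith .add 7 10 15, .arith .sub 7 7 11]),
    .arith .sub 8 6 7, .arith .mul 9 7 13, .arith .mul 6 6 12, .arith .sub 18 9 6,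
    .ite 18
      (.block [.arith .add 12 6 14, .arith .mul 13 13 7, .store 3 14, .arith .sub 11 11 5])
      (.block [.arith .sub 12 6 9, .arith .mul 13 13 8, .store 3 15, .arith .add 11 11 15,
        .arith .sub 11 11 5]),
    .ite 5 (.arith .sub 10 10 15) (.arith .add 10 10 15),
    .const 5 0, .const 6 0, .const 7 0, .const 8 0, .const 9 0, .const 18 0,
    .arith .sub 3 3 15]

/-- Sample the first bit, point to the list of gates and count them. -/
def gatesBeginProg : Prog := .block
  [.arith .sub 5 15 11, .store 14 5, .arith .add 5 2 15, .load 3 5, .arith .add 4 4 0,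
    .arith .sub 4 4 15, .const 5 0]

def sampleProg : Prog := .block
  [bitsInitProg, .loop 3 bitsBody, spinInitProg, .loop 3 spinBody, sampleInitProg,
    .loop 3 sampleBody, gatesBeginProg, .loop 3 gateForwardBody]

/-! ### Symbolic execution of the loop-free parts -/

/-- The stores between the parts of the programs. -/
def regs (n p K c P r9 r10 r11 r12 r13 r14 : ℕ) (m : ℕ → ℕ) : Store :=
  storeOf [n, p, K, c, P, 0, 0, 0, 0, r9, r10, r11, r12, r13, r14, 1, 2, 3, 0] m

/-- On bits, `t + uv - 2uvt` is the exclusive or of `t` and `uv`, and the truncated subtraction is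
exact. Clearing the scratch registers brings the store back to the form `regs`. -/
theorem eval_gateProg (n p K c P r9 r10 r11 r12 r13 r14 : ℕ) (m : ℕ → ℕ) :
    gateProg.eval (regs n p K c P r9 r10 r11 r12 r13 r14 m) =
      regs n p K c P r9 r10 r11 r12 r13 r14
        (Function.update m (m (P + 2)) (m (m (P + 2)) + m (m P) * m (m (P + 1)) -
          m (m P) * m (m (P + 1)) * m (m (P + 2)) * 2)) := by
  simp [regs, gateProg, Prog.block, Prog.eval, storeOf_setReg, ArithOp.eval]

theorem eval_gateBackwardBody (n p K c P r9 r10 r11 r12 r13 r14 : ℕ) (m : ℕ → ℕ) :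
    gateBackwardBody.eval (regs n p K (c + 1) (P + 3) r9 r10 r11 r12 r13 r14 m) =
      regs n p K c P r9 r10 r11 r12 r13 r14
        (Function.update m (m (P + 2)) (m (m (P + 2)) + m (m P) * m (m (P + 1)) -
          m (m P) * m (m (P + 1)) * m (m (P + 2)) * 2)) := by
  have h : (Prog.arith .sub 4 4 17).eval (regs n p K (c + 1) (P + 3) r9 r10 r11 r12 r13 r14 m) =
      regs n p K (c + 1) P r9 r10 r11 r12 r13 r14 m := by
    simp [regs, Prog.eval, storeOf_setReg, ArithOp.eval]
  simp only [gateBackwardBody, Prog.block, Prog.eval] at h ⊢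
  rw [h, eval_gateProg]
  simp [regs, storeOf_setReg, ArithOp.eval]

theorem eval_gateForwardBody (n p K c P r9 r10 r11 r12 r13 r14 : ℕ) (m : ℕ → ℕ) :
    gateForwardBody.eval (regs n p K (c + 1) P r9 r10 r11 r12 r13 r14 m) =
      regs n p K c (P + 3) r9 r10 r11 r12 r13 r14
        (Function.update m (m (P + 2)) (m (m (P + 2)) + m (m P) * m (m (P + 1)) -
          m (m P) * m (m (P + 1)) * m (m (P + 2)) * 2)) := by
  simp only [gateForwardBody, Prog.block, Prog.eval]
  rw [eval_gateProg]
  simp [regs, storeOf_setReg, ArithOp.eval]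

/-- The values computed along a path: twice the spin, the number `k`, the squared amplitude `N / D`
and the sign. -/
structure Walk where
  a : ℕ
  k : ℕ
  N : ℕ
  D : ℕ
  g : ℕ

/-- One step of a path, `s` being the step and `b` the value of the qubit. -/
def Walk.next (w : Walk) (s b : ℕ) : Walk :=
  if s = 0 then
    if b = 0 then ⟨w.a - 1, w.k, w.N * (w.a - w.k), w.D * (w.a + 1), 1 - w.g⟩
    else ⟨w.a - 1, w.k - 1, w.N * w.k, w.D * (w.a + 1), w.g⟩
  else
    if b = 0 then ⟨w.a + 1, w.k + 1, w.N * (w.k + 1), w.D * (w.a + 1), w.g⟩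
    else ⟨w.a + 1, w.k, w.N * (w.a + 1 - w.k), w.D * (w.a + 1), w.g⟩

def Walk.regs (w : Walk) (n p K c P r9 : ℕ) (m : ℕ → ℕ) : Store :=
  _root_.regs n p K c P r9 w.a w.k w.N w.D w.g m

theorem eval_walkBody (w : Walk) (n p K c P r9 : ℕ) (m : ℕ → ℕ) :
    walkBody.eval (w.regs n p K (c + 1) P r9 m) =
      (w.next (m P) (m r9)).regs n p K c (P + 1) (r9 + 1) m := by
  by_cases hs : m P = 0 <;> by_cases hb : m r9 = 0 <;>
  simp [Walk.regs, regs, Walk.next, walkBody, Prog.block, Prog.eval, storeOf_setReg, ArithOp.eval,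
    hs, hb]

theorem eval_walkInitProg (n p K P r9 r10 r11 r12 r13 r14 : ℕ) (m : ℕ → ℕ) :
    walkInitProg.eval (regs n p K 0 P r9 r10 r11 r12 r13 r14 m) =
      (Walk.mk 1 (1 - m 0) 1 1 0).regs n p K (n - 1) (K + 2) 1 m := by
  simp [Walk.regs, regs, walkInitProg, Prog.block, Prog.eval, storeOf_setReg, ArithOp.eval]

/-- A walk that ends at the wrong `k` must yield amplitude zero; setting the numerator to 0 treats
this case with the same square root code. Equality is tested by adding the two truncated
differences. -/
theorem eval_sqrtInitProg (w : Walk) (n p K P r9 : ℕ) (m : ℕ → ℕ) :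
    sqrtInitProg.eval (w.regs n p K 0 P r9 m) =
      regs n p K p P r9 ((if w.k = m K then w.N else 0) / w.D) 1 (if w.k = m K then w.N else 0)
        w.D w.g m := by
  by_cases h : w.k = m K
  · simp [Walk.regs, regs, sqrtInitProg, Prog.block, Prog.eval, storeOf_setReg, ArithOp.eval, h]
  · have : ¬ (m K - w.k = 0 ∧ w.k - m K = 0) := by omega
    simp [Walk.regs, regs, sqrtInitProg, Prog.block, Prog.eval, storeOf_setReg, ArithOp.eval, h,
      this]

/-- With truncated subtraction, `x ≤ y` is the test `y + 1 - x ≠ 0`. -/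
theorem eval_sqrtBody (n p K c P r9 r C N D g : ℕ) (m : ℕ → ℕ) :
    sqrtBody.eval (regs n p K (c + 1) P r9 r C N D g m) =
      regs n p K c P r9
        (if (2 * r + 1) ^ 2 * D ≤ 4 * N then 2 * r + 1 else 2 * r) (2 * C) (4 * N) D g m := by
  have h1 : r + r = 2 * r := by ring
  have h2 : C + C = 2 * C := by ring
  have h3 : N * 2 * 2 = 4 * N := by ring
  have h4 : (2 * r + 1) * (2 * r + 1) * D = (2 * r + 1) ^ 2 * D := by ring
  by_cases h : (2 * r + 1) ^ 2 * D ≤ 4 * N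
  · have : ¬ (4 * N + 1 - (2 * r + 1) ^ 2 * D = 0) := by omega
    simp [regs, sqrtBody, Prog.block, Prog.eval, storeOf_setReg, ArithOp.eval, h1, h2, h3, h4, h,
      this]
  · have : 4 * N + 1 - (2 * r + 1) ^ 2 * D = 0 := by omega
    simp [regs, sqrtBody, Prog.block, Prog.eval, storeOf_setReg, ArithOp.eval, h1, h2, h3, h4, h,
      this]

theorem eval_outputProg (n p K c P r9 r C N D g : ℕ) (m : ℕ → ℕ) :
    outputProg.eval (regs n p K c P r9 r C N D g m) =
      storeOf [if g = 0 then r else 0, if g = 0 then 0 else r, 0, 0, C, 0, 0, 0, 0, r9, r, C, N, D,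
        g, 1, 2, 3, 0] m := by
  by_cases h : g = 0 <;>
  simp [regs, outputProg, Prog.block, Prog.eval, storeOf_setReg, ArithOp.eval, h]

/-- The memory of the initial store. -/
def inputMem {K : ℕ} (x : Fin K → Bool) (d : List ℕ) : ℕ → ℕ :=
  fun i => ((List.ofFn fun j => (x j).toNat) ++ d).getD i 0

theorem initialStore_eq (n p : ℕ) {K : ℕ} (x : Fin K → Bool) (d : List ℕ) :
    initialStore n p x d =
      storeOf [n, p, K, 0, 0, 0, 0, 0, 0, 0, 0, 0, 0, 0, 0, 0, 0, 0, 0] (inputMem x d) := by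
  rw [initialStore, storeOf, Store.mk.injEq]
  refine ⟨funext fun i => ?_, rfl⟩
  rcases i with _ | _ | _ | i
  · rfl
  · rfl
  · rfl
  · have : (List.replicate 16 0).getD i 0 = 0 := by
      simp only [List.getD, List.getElem?_replicate]; split <;> rfl
    exact this.symm

theorem eval_gatesEndProg (n p K : ℕ) (m : ℕ → ℕ) :
    (Prog.block [constProg, gatesEndProg]).eval
        (storeOf [n, p, K, 0, 0, 0, 0, 0, 0, 0, 0, 0, 0, 0, 0, 0, 0, 0, 0] m) =
      regs n p K (m (K + 1)) (K + n + 1 + 3 * m (K + 1)) 0 0 0 0 0 0 m := by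
  simp [regs, constProg, gatesEndProg, Prog.block, Prog.eval, storeOf_setReg, ArithOp.eval,
    mul_comm]

theorem eval_bitsInitProg (n p K : ℕ) (m : ℕ → ℕ) :
    bitsInitProg.eval
        (storeOf [n, p, K, 0, 0, 0, 0, 0, 0, 0, 0, 0, 0, 0, 0, 0, 0, 0, 0] m) =
      regs n p K K 0 0 0 0 0 1 0 m := by
  simp [regs, constProg, bitsInitProg, Prog.block, Prog.eval, storeOf_setReg, ArithOp.eval]

theorem eval_bitsBody (n p K c P N D : ℕ) (m : ℕ → ℕ) :
    bitsBody.eval (regs n p K (c + 1) P 0 0 0 N D 0 m) =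
      regs n p K c (P + 1) 0 0 0 (N + m P * D) (2 * D) 0 m := by
  simp [regs, bitsBody, Prog.block, Prog.eval, storeOf_setReg, ArithOp.eval, two_mul]

theorem eval_spinInitProg (n p K P N D : ℕ) (m : ℕ → ℕ) :
    spinInitProg.eval (regs n p K 0 P 0 0 0 N D 0 m) =
      regs n p K (n - 1) (K + 2) 0 1 0 N D 0 m := by
  simp [regs, spinInitProg, Prog.block, Prog.eval, storeOf_setReg, ArithOp.eval]

theorem eval_spinBody (n p K c P a N D : ℕ) (m : ℕ → ℕ) :
    spinBody.eval (regs n p K (c + 1) P 0 a 0 N D 0 m) =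
      regs n p K c (P + 1) 0 (if m P = 0 then a - 1 else a + 1) 0 N D 0 m := by
  by_cases h : m P = 0 <;>
  simp [regs, spinBody, Prog.block, Prog.eval, storeOf_setReg, ArithOp.eval, h]

theorem eval_sampleInitProg (n p K P a N D : ℕ) (m : ℕ → ℕ) :
    sampleInitProg.eval (regs n p K 0 P 0 a 0 N D 0 m) =
      regs n p K (n - 1) P 0 a (m K) N D 0 m := by
  simp [regs, sampleInitProg, Prog.block, Prog.eval, storeOf_setReg, ArithOp.eval]

/-- The test is `N / D < k / (a + 1)` without denominators, the right side being the probability of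
the bit 0. The counter doubles as the address of the sampled bit and runs from `n - 1` to 1, so cell
0 is left to `gatesBeginProg`. -/
theorem eval_sampleBody_up (n p K c P a k N D : ℕ) (m : ℕ → ℕ) (hP : m P = 1) :
    sampleBody.eval (regs n p K (c + 1) (P + 1) 0 (a + 1) k N D 0 m) =
      if N * (a + 1) < k * D then
        regs n p K c P 0 a (k - 1) (N * (a + 1)) (D * k) 0 (Function.update m (c + 1) 0)
      else
        regs n p K c P 0 a k (N * (a + 1) - k * D) (D * (a + 1 - k)) 0
          (Function.update m (c + 1) 1) := by
  by_cases h : N * (a + 1) < k * D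
  · have : ¬ (k * D - N * (a + 1) = 0) := by omega
    simp [regs, sampleBody, Prog.block, Prog.eval, storeOf_setReg, ArithOp.eval, h, hP, this,
      mul_comm (a + 1)]
  · have : k * D - N * (a + 1) = 0 := by omega
    simp [regs, sampleBody, Prog.block, Prog.eval, storeOf_setReg, ArithOp.eval, h, hP, this,
      mul_comm (a + 1)]

/-- The threshold is now `(a + 1 - k) / (a + 2)`. For `k ≤ a` the difference `a + 2 - (a + 1 - k)`
is `k + 1`. -/
theorem eval_sampleBody_down (n p K c P a k N D : ℕ) (m : ℕ → ℕ) (hP : m P = 0) :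
    sampleBody.eval (regs n p K (c + 1) (P + 1) 0 a k N D 0 m) =
      if N * (a + 2) < (a + 1 - k) * D then
        regs n p K c P 0 (a + 1) k (N * (a + 2)) (D * (a + 1 - k)) 0
          (Function.update m (c + 1) 0)
      else
        regs n p K c P 0 (a + 1) (k + 1) (N * (a + 2) - (a + 1 - k) * D)
          (D * (a + 2 - (a + 1 - k))) 0 (Function.update m (c + 1) 1) := by
  by_cases h : N * (a + 2) < (a + 1 - k) * D
  · have : ¬ ((a + 1 - k) * D - N * (a + 2) = 0) := by omega
    simp [regs, sampleBody, Prog.block, Prog.eval, storeOf_setReg, ArithOp.eval, h, hP, this,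
      mul_comm (a + 2)]
  · have : (a + 1 - k) * D - N * (a + 2) = 0 := by omega
    simp [regs, sampleBody, Prog.block, Prog.eval, storeOf_setReg, ArithOp.eval, h, hP, this,
      mul_comm (a + 2)]

/-- For a single qubit `k = 1` is `|0⟩` and `k = 0` is `|1⟩`, so the first bit is `1 - k`. -/
theorem eval_gatesBeginProg (n p K a k N D : ℕ) (m : ℕ → ℕ) (hK : 0 < K) :
    gatesBeginProg.eval (regs n p K 0 (K + 2) 0 a k N D 0 m) =
      regs n p K (m (K + 1)) (K + n + 1) 0 a k N D 0 (Function.update m 0 (1 - k)) := by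
  have : K + 2 + n - 1 = K + n + 1 := by omega
  simp [regs, gatesBeginProg, Prog.block, Prog.eval, storeOf_setReg, ArithOp.eval, this]

theorem regs_bounded {B n p K c P r9 r10 r11 r12 r13 r14 : ℕ} {m : ℕ → ℕ}
    (h : ∀ v ∈ [n, p, K, c, P, r9, r10, r11, r12, r13, r14, 3], v < 2 ^ B)
    (hm : ∀ i, m i < 2 ^ B) : (regs n p K c P r9 r10 r11 r12 r13 r14 m).Bounded B := by
  refine storeOf_bounded ?_ hm
  simp only [List.forall_mem_cons, List.not_mem_nil, false_imp_iff, implies_true, and_true] at h ⊢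
  omega

/-! ### Applying the gates -/

/-- The memory that holds the bit string `x` in its first cells and agrees with `m` elsewhere. -/
def layout {n : ℕ} (x : Fin n → Bool) (m : ℕ → ℕ) : ℕ → ℕ :=
  fun i => if h : i < n then (x ⟨i, h⟩).toNat else m i

theorem layout_fin {n : ℕ} (x : Fin n → Bool) (m : ℕ → ℕ) (i : Fin n) :
    layout x m i = (x i).toNat := by
  simp [layout]

theorem layout_of_le {n : ℕ} (x : Fin n → Bool) (m : ℕ → ℕ) {i : ℕ} (h : n ≤ i) :
    layout x m i = m i := by
  simp [layout, h]

theorem toNat_lt_two_pow {B : ℕ} (hB : 1 ≤ B) (b : Bool) : b.toNat < 2 ^ B :=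
  (Bool.toNat_lt b).trans_le (by simpa using Nat.pow_le_pow_right two_pos hB)

theorem layout_lt {B n : ℕ} (hB : 1 ≤ B) (x : Fin n → Bool) {m : ℕ → ℕ} (hm : ∀ i, m i < 2 ^ B)
    (i : ℕ) : layout x m i < 2 ^ B := by
  unfold layout
  split
  · exact toNat_lt_two_pow hB _
  · exact hm i

theorem update_layout {n : ℕ} (x : Fin n → Bool) (m : ℕ → ℕ) (i : Fin n) (b : Bool) :
    Function.update (layout x m) i b.toNat = layout (Function.update x i b) m := by
  funext j
  by_cases hj : j = i
  · subst hj; simp [layout]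
  · rw [Function.update_of_ne hj]
    unfold layout
    split
    · rw [Function.update_of_ne (fun h => hj (congrArg Fin.val h))]
    · rfl

/-- The memory `m` holds the wires of the gates of `C`, starting at address `A`. -/
def Coded {n : ℕ} (C : List (Toffoli n)) (A : ℕ) (m : ℕ → ℕ) : Prop :=
  ∀ (j : ℕ) (h : j < C.length), m (A + 3 * j) = C[j].control₁ ∧
    m (A + 3 * j + 1) = C[j].control₂ ∧ m (A + 3 * j + 2) = C[j].target

/-- The code of the gates lies beyond the first `n` cells, so rewriting the bit string leaves it
intact. The arithmetic form of the exclusive or is checked on the eight values of the three bits. -/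
theorem update_gate {n A : ℕ} (g : Toffoli n) (x : Fin n → Bool) (m : ℕ → ℕ) (hA : n ≤ A)
    (h₁ : m A = g.control₁) (h₂ : m (A + 1) = g.control₂) (h₃ : m (A + 2) = g.target) :
    Function.update (layout x m) (layout x m (A + 2))
      (layout x m (layout x m (A + 2)) + layout x m (layout x m A) * layout x m (layout x m (A + 1)) -
        layout x m (layout x m A) * layout x m (layout x m (A + 1)) *
          layout x m (layout x m (A + 2)) * 2) = layout (g.apply x) m := by
  rw [layout_of_le x m hA, layout_of_le x m (by omega : n ≤ A + 1),
    layout_of_le x m (by omega : n ≤ A + 2), h₁, h₂, h₃]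
  simp only [layout_fin]
  rw [Toffoli.apply, ← update_layout]
  congr 1
  cases x g.control₁ <;> cases x g.control₂ <;> cases x g.target <;> rfl

theorem Coded.init {n : ℕ} {C : List (Toffoli n)} {g : Toffoli n} {A : ℕ} {m : ℕ → ℕ}
    (h : Coded (C ++ [g]) A m) : Coded C A m := by
  intro j hj
  have h' := h j (by simp; omega)
  rwa [List.getElem_append_left hj] at h'

theorem Coded.tail {n : ℕ} {C : List (Toffoli n)} {g : Toffoli n} {A : ℕ} {m : ℕ → ℕ}
    (h : Coded (g :: C) A m) : Coded C (A + 3) m := by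
  intro j hj
  have := h (j + 1) (by simpa using hj)
  rw [show A + 3 * (j + 1) = A + 3 + 3 * j by ring] at this
  simpa using this

theorem coded_of_getD {n : ℕ} (C : List (Toffoli n)) (A : ℕ) (m : ℕ → ℕ)
    (h : ∀ i, m (A + i) = (C.flatMap Toffoli.code).getD i 0) : Coded C A m := by
  induction C generalizing A with
  | nil => intro j hj; simp at hj
  | cons g C ih =>
    have h3 : ∀ i, m (A + 3 + i) = (C.flatMap Toffoli.code).getD i 0 := by
      intro i
      rw [add_assoc, add_comm 3 i, h]
      simp [Toffoli.code]
    intro j hj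
    rcases j with _ | j
    · have h0 := h 0
      have h1 := h 1
      have h2 := h 2
      simpa [Toffoli.code] using And.intro h0 (And.intro h1 h2)
    · have := ih (A + 3) h3 j (by simpa using hj)
      rw [show A + 3 * (j + 1) = A + 3 + 3 * j by ring]
      simpa using this

/-- Induction on the list from its end: the pointer starts just behind the last gate, so the inverse
circuit needs no second copy of the gates. -/
theorem runs_gateBackward {B n p K r9 r10 r11 r12 r13 r14 A : ℕ} {m : ℕ → ℕ} (hB : 1 ≤ B)
    (hr : ∀ v ∈ [n, p, K, r9, r10, r11, r12, r13, r14, 3], v < 2 ^ B) (hm : ∀ i, m i < 2 ^ B)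
    (hA : n ≤ A) (C : List (Toffoli n)) (x : Fin n → Bool) (hC : Coded C A m)
    (hlt : A + 3 * C.length < 2 ^ B) :
    Runs (.loop 3 gateBackwardBody)
      (regs n p K C.length (A + 3 * C.length) r9 r10 r11 r12 r13 r14 (layout x m))
      (regs n p K 0 A r9 r10 r11 r12 r13 r14 (layout (circuitFun C.reverse x) m))
      (loopFactor gateBackwardBody C.length * B) := by
  have hb : ∀ (C : List (Toffoli n)) (x : Fin n → Bool), A + 3 * C.length < 2 ^ B →
      (regs n p K C.length (A + 3 * C.length) r9 r10 r11 r12 r13 r14 (layout x m)).Bounded B := by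
    intro C x hlt
    refine regs_bounded ?_ (layout_lt hB x hm)
    simp only [List.forall_mem_cons, List.not_mem_nil, false_imp_iff, implies_true, and_true] at hr ⊢
    omega
  induction C using List.reverseRecOn generalizing x with
  | nil =>
    exact (runs_loop_zero (hb [] x hlt) rfl).mono (loopFactor_zero hB _)
  | append_singleton C g ih =>
    have hbd := hb (C ++ [g]) x hlt
    have hg := hC C.length (by simp)
    simp only [List.getElem_concat_length] at hg
    have h1 := gateBackwardBody.runs_eval hB _ rfl hbd
    simp only [List.length_append, List.length_singleton] at h1 hbd hlt ⊢
    rw [show A + 3 * (C.length + 1) = A + 3 * C.length + 3 by ring] at h1 hbd ⊢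
    rw [eval_gateBackwardBody, update_gate g x m (by omega) hg.1 hg.2.1 hg.2.2] at h1
    have h2 := ih (g.apply x) hC.init (by omega)
    rw [show circuitFun (C ++ [g]).reverse x = circuitFun C.reverse (g.apply x) by
      simp [circuitFun]]
    exact (Runs.loop_step (a := 3) hbd (Nat.succ_ne_zero C.length) h1 h2).mono
      (loopFactor_succ hB _ _)

theorem runs_gateForward {B n p K r9 r10 r11 r12 r13 r14 A : ℕ} {m : ℕ → ℕ} (hB : 1 ≤ B)
    (hr : ∀ v ∈ [n, p, K, r9, r10, r11, r12, r13, r14, 3], v < 2 ^ B) (hm : ∀ i, m i < 2 ^ B)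
    (hA : n ≤ A) (C : List (Toffoli n)) (x : Fin n → Bool) (hC : Coded C A m)
    (hlt : A + 3 * C.length < 2 ^ B) :
    Runs (.loop 3 gateForwardBody)
      (regs n p K C.length A r9 r10 r11 r12 r13 r14 (layout x m))
      (regs n p K 0 (A + 3 * C.length) r9 r10 r11 r12 r13 r14 (layout (circuitFun C x) m))
      (loopFactor gateForwardBody C.length * B) := by
  induction C generalizing x A with
  | nil =>
    refine (runs_loop_zero (regs_bounded ?_ (layout_lt hB x hm)) rfl).mono
      (loopFactor_zero hB _)
    simp only [List.forall_mem_cons, List.not_mem_nil, false_imp_iff, implies_true, and_true] at hr ⊢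
    simp at hlt ⊢
    omega
  | cons g C ih =>
    have hg := hC 0 (by simp)
    simp only [List.getElem_cons_zero, mul_zero, add_zero] at hg
    simp only [List.length_cons] at hlt ⊢
    have hbd : (regs n p K (C.length + 1) A r9 r10 r11 r12 r13 r14 (layout x m)).Bounded B := by
      refine regs_bounded ?_ (layout_lt hB x hm)
      simp only [List.forall_mem_cons, List.not_mem_nil, false_imp_iff, implies_true, and_true] at hr ⊢
      omega
    have h1 := gateForwardBody.runs_eval hB _ rfl hbd
    rw [eval_gateForwardBody, update_gate g x m hA hg.1 hg.2.1 hg.2.2] at h1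
    have h2 := ih (by omega) (g.apply x) hC.tail (by omega)
    rw [show A + 3 * (C.length + 1) = A + 3 + 3 * C.length by ring]
    exact (Runs.loop_step (a := 3) hbd (Nat.succ_ne_zero C.length) h1 h2).mono
      (loopFactor_succ hB _ _)

/-! ### Circuits as permutations -/

/-- The target differs from both controls, so the second application sees the same controls and
flips the same bit again. -/
theorem Toffoli.apply_apply {n : ℕ} (g : Toffoli n) (x : Fin n → Bool) :
    g.apply (g.apply x) = x := by
  unfold Toffoli.apply
  funext i
  by_cases hi : i = g.target
  · subst hi
    simp [Function.update_of_ne g.target_ne₁, Function.update_of_ne g.target_ne₂]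
  · simp [hi]

theorem circuitFun_reverse_circuitFun {n : ℕ} (C : List (Toffoli n)) (x : Fin n → Bool) :
    circuitFun C.reverse (circuitFun C x) = x := by
  induction C generalizing x with
  | nil => rfl
  | cons g C ih =>
    have h1 : circuitFun (g :: C) x = circuitFun C (g.apply x) := rfl
    have h2 : ∀ y, circuitFun (g :: C).reverse y = g.apply (circuitFun C.reverse y) := by
      intro y; simp [circuitFun]
    rw [h1, h2, ih, g.apply_apply]

theorem circuitFun_circuitFun_reverse {n : ℕ} (C : List (Toffoli n)) (x : Fin n → Bool) :
    circuitFun C (circuitFun C.reverse x) = x := by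
  simpa using circuitFun_reverse_circuitFun C.reverse x

theorem circuitFun_eq_iff {n : ℕ} (C : List (Toffoli n)) (x y : Fin n → Bool) :
    circuitFun C x = y ↔ x = circuitFun C.reverse y :=
  ⟨fun h => by rw [← h, circuitFun_reverse_circuitFun],
    fun h => by rw [h, circuitFun_circuitFun_reverse]⟩

theorem circuitOp_mulVec {n : ℕ} (C : List (Toffoli n)) (ψ : QState n) (y : Fin n → Bool) :
    (circuitOp C).mulVec ψ y = ψ (circuitFun C.reverse y) := by
  simp [circuitOp, Matrix.mulVec, dotProduct, circuitFun_eq_iff]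

theorem sum_filter_circuitFun {n : ℕ} (C : List (Toffoli n)) (f : (Fin n → Bool) → ℝ)
    (y : Fin n → Bool) :
    ∑ x ∈ Finset.univ.filter (fun x => circuitFun C x = y), f x = f (circuitFun C.reverse y) := by
  simp [circuitFun_eq_iff, Finset.sum_filter]

/-! ### The recursion for the amplitudes -/

/-- The amplitude `⟨x|J, -J + k⟩`. -/
noncomputable def SpinPath.amp {n a : ℕ} (P : SpinPath n a) (k : ℕ) : QState n :=
  P.state (2 * (k : ℤ) - (a : ℤ))

theorem SpinPath.amp_one (k : ℕ) (x : Fin 1 → Bool) :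
    SpinPath.one.amp k x = if 1 - (x 0).toNat = k then 1 else 0 := by
  cases h : x 0
  · by_cases hk : k = 1
    · subst hk; simp [amp, state, twoSpin, h]
    · have : ¬ (2 * (k : ℤ) - (1 : ℕ) = 1) := by omega
      have : ¬ (1 = k) := by omega
      simp_all [amp, state, twoSpin]
  · by_cases hk : k = 0
    · subst hk; simp [amp, state, twoSpin, h]
    · have : ¬ (2 * (k : ℤ) - (1 : ℕ) = -1) := by omega
      have : ¬ (0 = k) := by omega
      simp_all [amp, state, twoSpin]

theorem SpinPath.amp_up_true {n a : ℕ} (P : SpinPath n a) (k : ℕ) (x : Fin (n + 1) → Bool)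
    (hx : x (Fin.last n) = true) :
    P.up.amp k x = (√((a + 1 - k) / (a + 1)) : ℝ) * P.amp k (Fin.init x) := by
  have h1 : 2 * (k : ℤ) - ((a + 1 : ℕ) : ℤ) - -1 = 2 * k - a := by push_cast; ring
  simp only [amp, state, hx, twoSpin, clebschUp, if_true, h1]
  congr 4
  · push_cast; ring
  · ring

/-- The predecessor would have `k = -1`. The coefficient itself vanishes, so the value of the
shorter state at this meaningless label does not matter. -/
theorem SpinPath.amp_up_false_zero {n a : ℕ} (P : SpinPath n a) (x : Fin (n + 1) → Bool)
    (hx : x (Fin.last n) = false) : P.up.amp 0 x = 0 := by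
  have h : (a : ℝ) / 2 + ((2 * ((0 : ℕ) : ℤ) - ((a + 1 : ℕ) : ℤ) : ℤ) : ℝ) / 2 + 1 / 2 = 0 := by
    push_cast; ring
  simp only [amp, state, hx, clebschUp, Bool.false_eq_true, if_false, h]
  simp

theorem SpinPath.amp_up_false_succ {n a : ℕ} (P : SpinPath n a) (k : ℕ) (x : Fin (n + 1) → Bool)
    (hx : x (Fin.last n) = false) :
    P.up.amp (k + 1) x = (√((k + 1) / (a + 1)) : ℝ) * P.amp k (Fin.init x) := by
  have h1 : 2 * ((k + 1 : ℕ) : ℤ) - ((a + 1 : ℕ) : ℤ) - 1 = 2 * k - a := by push_cast; ring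
  simp only [amp, state, hx, twoSpin, clebschUp, Bool.false_eq_true, if_false, h1]
  congr 4
  · push_cast; ring
  · ring

theorem SpinPath.amp_down_true {n a : ℕ} (P : SpinPath n (a + 1)) (k : ℕ)
    (x : Fin (n + 1) → Bool) (hx : x (Fin.last n) = true) :
    P.down.amp k x = (√((k + 1) / (a + 2)) : ℝ) * P.amp (k + 1) (Fin.init x) := by
  have h1 : 2 * (k : ℤ) - (a : ℤ) - -1 = 2 * ((k + 1 : ℕ) : ℤ) - ((a + 1 : ℕ) : ℤ) := by
    push_cast; ring
  simp only [amp, state, hx, twoSpin, clebschDown, if_true, h1]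
  congr 4
  · push_cast; ring
  · push_cast; ring

theorem SpinPath.amp_down_false {n a : ℕ} (P : SpinPath n (a + 1)) (k : ℕ)
    (x : Fin (n + 1) → Bool) (hx : x (Fin.last n) = false) :
    P.down.amp k x = -(√((a + 1 - k) / (a + 2)) : ℝ) * P.amp k (Fin.init x) := by
  have h1 : 2 * (k : ℤ) - (a : ℤ) - 1 = 2 * (k : ℤ) - ((a + 1 : ℕ) : ℤ) := by
    push_cast; ring
  simp only [amp, state, hx, twoSpin, clebschDown, Bool.false_eq_true, if_false, h1,
    Complex.ofReal_neg]
  congr 5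
  · push_cast; ring
  · push_cast; ring

theorem SpinPath.one_le {n a : ℕ} (P : SpinPath n a) : 1 ≤ n := by
  cases P <;> omega

theorem SpinPath.le {n a : ℕ} (P : SpinPath n a) : a ≤ n := by
  induction P <;> omega

theorem SpinPath.length_steps {n a : ℕ} (P : SpinPath n a) : P.steps.length = n - 1 := by
  induction P with
  | one => rfl
  | up P ih | down P ih => have := P.one_le; simp [steps, ih]; omega

theorem SpinPath.steps_le_one {n a : ℕ} (P : SpinPath n a) : ∀ s ∈ P.steps, s ≤ 1 := by
  induction P with
  | one => simp [steps]
  | up P ih | down P ih =>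
    intro s hs
    simp only [steps, List.mem_append, List.mem_singleton] at hs
    rcases hs with hs | hs
    · exact ih s hs
    · omega

theorem SpinPath.getD_steps_up {n a : ℕ} (P : SpinPath n a) {i : ℕ} (hi : i < n - 1) :
    P.up.steps.getD i 0 = P.steps.getD i 0 := by
  rw [steps, List.getD_append]; rwa [P.length_steps]

theorem SpinPath.getD_steps_up_last {n a : ℕ} (P : SpinPath n a) :
    P.up.steps.getD (n - 1) 0 = 1 := by
  rw [steps, List.getD_append_right _ _ _ _ P.length_steps.le, P.length_steps]; simp

theorem SpinPath.getD_steps_down {n a : ℕ} (P : SpinPath n (a + 1)) {i : ℕ} (hi : i < n - 1) :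
    P.down.steps.getD i 0 = P.steps.getD i 0 := by
  rw [steps, List.getD_append]; rwa [P.length_steps]

theorem SpinPath.getD_steps_down_last {n a : ℕ} (P : SpinPath n (a + 1)) :
    P.down.steps.getD (n - 1) 0 = 0 := by
  rw [steps, List.getD_append_right _ _ _ _ P.length_steps.le, P.length_steps]; simp

/-! ### The walk along a path -/

/-- The values computed after `i` steps `s` on a bit string `b`. -/
def walk (s b : ℕ → ℕ) : ℕ → Walk
  | 0 => ⟨1, 1 - b 0, 1, 1, 0⟩
  | i + 1 => (walk s b i).next (s i) (b (i + 1))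

theorem walk_pred (s b : ℕ → ℕ) {n : ℕ} (hn : 1 ≤ n) :
    walk s b n = (walk s b (n - 1)).next (s (n - 1)) (b n) := by
  obtain ⟨n, rfl⟩ := Nat.exists_eq_add_of_le' hn
  rfl

/-- The squared amplitude is a fraction between `0` and `1`. -/
structure Walk.Valid (w : Walk) : Prop where
  k_le : w.N = 0 ∨ w.k ≤ w.a
  N_le : w.N ≤ w.D
  D_pos : 0 < w.D
  g_le : w.g ≤ 1

/-- Only a step down can take `k` out of the range from 0 to `a`, namely from `k = a` with bit 0 or
from `k = 0` with bit 1. In both cases `N` is multiplied by 0, and from then on `k` is irrelevant.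
All factors of a nonzero `N` are at most `a + 1`, which keeps `N ≤ D`. -/
theorem Walk.Valid.next {w : Walk} (h : w.Valid) (s b : ℕ) : (w.next s b).Valid := by
  obtain ⟨h1, h2, h3, h4⟩ := h
  have key : ∀ u, (w.N = 0 ∨ u ≤ w.a + 1) → w.N * u ≤ w.D * (w.a + 1) := by
    rintro u (h | h)
    · simp [h]
    · exact Nat.mul_le_mul h2 h
  unfold Walk.next
  split_ifs
  · refine ⟨?_, key _ (by omega), by positivity, by simp⟩
    rcases h1 with h1 | h1
    · simp [h1]
    · rcases h1.eq_or_lt with h1 | h1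
      · simp [h1]
      · right; simp only; omega
  · refine ⟨?_, key _ (by omega), by positivity, by simpa⟩
    rcases h1 with h1 | h1
    · simp [h1]
    · rcases Nat.eq_zero_or_pos w.k with h0 | h0
      · simp [h0]
      · right; simp only; omega
  · exact ⟨by rcases h1 with h1 | h1 <;> simp [h1], key _ (by omega), by positivity, by simpa⟩
  · exact ⟨by rcases h1 with h1 | h1 <;> simp [h1]; omega, key _ (by omega), by positivity, by simpa⟩

theorem walk_valid (s b : ℕ → ℕ) (i : ℕ) : (walk s b i).Valid := by
  induction i with
  | zero => exact ⟨by simp [walk], by simp [walk], by simp [walk], by simp [walk]⟩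
  | succ i ih => exact ih.next _ _

theorem walk_a_le (s b : ℕ → ℕ) (i : ℕ) : (walk s b i).a ≤ i + 1 := by
  induction i with
  | zero => simp [walk]
  | succ i ih => simp only [walk, Walk.next]; split_ifs <;> simp only <;> omega

theorem walk_k_le (s b : ℕ → ℕ) (i : ℕ) : (walk s b i).k ≤ i + 1 := by
  induction i with
  | zero => simp [walk]
  | succ i ih => simp only [walk, Walk.next]; split_ifs <;> simp only <;> omega

/-- The step after `i` steps contributes the factor `a + 1 ≤ i + 2`. This is why exact fractions are
affordable: they have polynomially many bits. -/
theorem walk_D_le (s b : ℕ → ℕ) {n i : ℕ} (hi : i < n) : (walk s b i).D ≤ n ^ i := by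
  induction i with
  | zero => simp [walk]
  | succ i ih =>
    have h : (walk s b (i + 1)).D = (walk s b i).D * ((walk s b i).a + 1) := by
      simp only [walk, Walk.next]; split_ifs <;> rfl
    have := walk_a_le s b i
    rw [h, pow_succ]
    exact Nat.mul_le_mul (ih (by omega)) (by omega)

theorem neg_one_pow_one_sub {g : ℕ} (hg : g ≤ 1) : (-1 : ℂ) ^ (1 - g) = -(-1) ^ g := by
  interval_cases g <;> simp

/-- The number that the walk describes. -/
noncomputable def Walk.value (w : Walk) : ℂ := (-1) ^ w.g * (√(w.N / w.D) : ℝ)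

theorem Walk.value_eq_zero {w : Walk} (h : w.N = 0) : w.value = 0 := by
  simp [value, h]

theorem sqrt_mul_value (w : Walk) {u v : ℝ} (hu : 0 ≤ u) (hv : 0 < v) :
    ((√(u / v) : ℝ) : ℂ) * w.value = (-1) ^ w.g * (√(w.N * u / (w.D * v)) : ℝ) := by
  have : √(w.N * u / (w.D * v)) = √(u / v) * √(w.N / w.D) := by
    rw [← Real.sqrt_mul (by positivity)]; congr 1; rw [div_mul_div_comm]; ring
  rw [this, Walk.value]; push_cast; ring

/-- For a given string at most one `k` has a nonzero amplitude, and the walk finds it. The induction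
needs all `k ≤ a` at once because a step may shift `k`; where truncated subtraction could give a
false match, the numerator vanishes. -/
theorem walk_spec {n a : ℕ} (P : SpinPath n a) (x : Fin n → Bool) (s b : ℕ → ℕ)
    (hs : ∀ i < n - 1, s i = P.steps.getD i 0) (hb : ∀ i : Fin n, b i = (x i).toNat) :
    (walk s b (n - 1)).a = a ∧ ∀ k ≤ a, P.amp k x =
      if (walk s b (n - 1)).k = k then (walk s b (n - 1)).value else 0 := by
  induction P with
  | one =>
    refine ⟨rfl, fun k _ => ?_⟩
    rw [SpinPath.amp_one, ← hb 0]
    simp [walk, Walk.value]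
  | @up n a P ih =>
    obtain ⟨iha, ihk⟩ := ih (Fin.init x)
      (fun i hi => (hs i (by omega)).trans (P.getD_steps_up hi)) (fun i => hb i.castSucc)
    have hn := P.one_le
    have hval := walk_valid s b (n - 1)
    have hw : walk s b (n + 1 - 1) = (walk s b (n - 1)).next 1 (x (Fin.last n)).toNat := by
      have h := walk_pred s b hn
      rwa [(hs (n - 1) (by omega)).trans P.getD_steps_up_last,
        show b n = _ from hb (Fin.last n)] at h
    rw [hw]
    generalize walk s b (n - 1) = w at iha ihk hval
    cases hx : x (Fin.last n) with
    | false =>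
      simp only [Bool.toNat_false, Walk.next, one_ne_zero, if_false, if_true, iha, true_and]
      rintro (_ | k) hk
      · rw [P.amp_up_false_zero x hx]; simp
      · rw [P.amp_up_false_succ k x hx, ihk k (by omega)]
        simp only [add_left_inj]
        split_ifs with h
        · rw [sqrt_mul_value w (by positivity) (by positivity), Walk.value]
          simp [h]
        · simp
    | true =>
      simp only [Bool.toNat_true, Walk.next, one_ne_zero, if_false, iha, true_and]
      intro k hk
      rw [P.amp_up_true k x hx]
      -- The induction hypothesis does not reach `k = a + 1`; there the coefficient and the factor
      -- `a + 1 - k` are both 0.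
      rcases hk.eq_or_lt with rfl | hk
      · simp only [Nat.cast_add, Nat.cast_one, sub_self, zero_div, Real.sqrt_zero,
          Complex.ofReal_zero, zero_mul]
        split_ifs with h
        · rw [Walk.value_eq_zero]; simp [h]
        · rfl
      · rw [ihk k (by omega)]
        split_ifs with h
        · have h' : (0 : ℝ) ≤ a + 1 - k := by
            have : (k : ℝ) ≤ a + 1 := by exact_mod_cast hk.le
            linarith
          rw [sqrt_mul_value w h' (by positivity), Walk.value]
          simp [h, Nat.cast_sub hk.le]
        · simp
  | @down n a P ih =>
    obtain ⟨iha, ihk⟩ := ih (Fin.init x)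
      (fun i hi => (hs i (by omega)).trans (P.getD_steps_down hi)) (fun i => hb i.castSucc)
    have hn := P.one_le
    have hval := walk_valid s b (n - 1)
    have hw : walk s b (n + 1 - 1) = (walk s b (n - 1)).next 0 (x (Fin.last n)).toNat := by
      have h := walk_pred s b hn
      rwa [(hs (n - 1) (by omega)).trans P.getD_steps_down_last,
        show b n = _ from hb (Fin.last n)] at h
    rw [hw]
    generalize walk s b (n - 1) = w at iha ihk hval
    have h2 : (a : ℝ) + 2 = a + 1 + 1 := by ring
    cases hx : x (Fin.last n) with
    | false =>
      simp only [Bool.toNat_false, Walk.next, if_true, iha, Nat.add_sub_cancel, true_and]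
      intro k hk
      rw [P.amp_down_false k x hx, ihk k (by omega)]
      split_ifs with h
      · have h' : (0 : ℝ) ≤ a + 1 - k := by
          have : (k : ℝ) ≤ a := by exact_mod_cast hk
          linarith
        rw [neg_mul, sqrt_mul_value w h' (by positivity), Walk.value]
        simp [h, Nat.cast_sub (by omega : k ≤ a + 1), neg_one_pow_one_sub hval.g_le, h2]
      · simp
    | true =>
      simp only [Bool.toNat_true, Walk.next, one_ne_zero, if_false, if_true, iha,
        Nat.add_sub_cancel, true_and]
      intro k hk
      rw [P.amp_down_true k x hx, ihk (k + 1) (by omega)]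
      by_cases h : w.k = k + 1
      · rw [if_pos h, if_pos (by omega), sqrt_mul_value w (by positivity) (by positivity),
          Walk.value]
        simp [h, h2]
      · rw [if_neg h, mul_zero]
        -- Truncation makes `w.k - 1 = k` possible here only for `w.k = k = 0`, where the new
        -- numerator is 0.
        split_ifs with h'
        · rw [Walk.value_eq_zero]; simp; omega
        · rfl

/-! ### Square roots -/

/-- The square root of `4 ^ q * N / D`, rounded down. -/
def sqrtDigits (N D : ℕ) : ℕ → ℕ
  | 0 => N / D
  | q + 1 =>
    if (2 * sqrtDigits N D q + 1) ^ 2 * D ≤ 4 * (4 ^ q * N) then 2 * sqrtDigits N D q + 1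
    else 2 * sqrtDigits N D q

/-- Multiplying the invariant for `r` by 4 places the new root between `2r` and `2r + 2`, so
comparing with `2r + 1` decides the next digit. At the start `N ≤ D` makes the root at most 1, and
its integer part is then `N / D`. -/
theorem sqrtDigits_spec {N D : ℕ} (hN : N ≤ D) (hD : 0 < D) (q : ℕ) :
    sqrtDigits N D q ^ 2 * D ≤ 4 ^ q * N ∧ 4 ^ q * N < (sqrtDigits N D q + 1) ^ 2 * D := by
  induction q with
  | zero =>
    rcases hN.eq_or_lt with rfl | h
    · simp [sqrtDigits, Nat.div_self hD]; omega
    · simp [sqrtDigits, Nat.div_eq_of_lt h, h]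
  | succ q ih =>
    obtain ⟨h1, h2⟩ := ih
    rw [sqrtDigits, pow_succ' 4, mul_assoc 4]
    split_ifs with h
    · exact ⟨h, by nlinarith⟩
    · exact ⟨by nlinarith, by simpa using h⟩

theorem sqrtDigits_le {N D : ℕ} (hN : N ≤ D) (hD : 0 < D) (q : ℕ) :
    sqrtDigits N D q ≤ 2 ^ q := by
  have h1 := (sqrtDigits_spec hN hD q).1
  have h2 : sqrtDigits N D q ^ 2 * D ≤ (2 ^ q) ^ 2 * D := by
    rw [← pow_mul, mul_comm q, pow_mul]
    exact h1.trans (Nat.mul_le_mul_left _ hN)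
  exact (Nat.pow_le_pow_iff_left two_ne_zero).1 (Nat.le_of_mul_le_mul_right h2 hD)

theorem abs_sqrtDigits_sub_le {N D : ℕ} (hN : N ≤ D) (hD : 0 < D) (q : ℕ) :
    |(sqrtDigits N D q : ℝ) / 2 ^ q - √((N : ℝ) / D)| ≤ ((2 : ℝ) ^ q)⁻¹ := by
  obtain ⟨h1, h2⟩ := sqrtDigits_spec hN hD q
  set r := sqrtDigits N D q
  have hD' : (0 : ℝ) < D := by exact_mod_cast hD
  have hq : ((2 : ℝ) ^ q) ^ 2 = 4 ^ q := by rw [← pow_mul, mul_comm, pow_mul]; norm_num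
  have h1' : (r : ℝ) / 2 ^ q ≤ √((N : ℝ) / D) := by
    refine Real.le_sqrt_of_sq_le ?_
    rw [div_pow, hq, div_le_div_iff₀ (by positivity) hD', mul_comm (N : ℝ)]
    exact_mod_cast h1
  have h2' : √((N : ℝ) / D) ≤ ((r : ℝ) + 1) / 2 ^ q := by
    refine Real.sqrt_le_iff.2 ⟨by positivity, ?_⟩
    rw [div_pow, hq, div_le_div_iff₀ hD' (by positivity), mul_comm (N : ℝ)]
    exact_mod_cast h2.le
  rw [add_div, one_div] at h2'
  rw [abs_le]
  constructor <;> linarith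

theorem runs_sqrt {B n p K P r9 N D g : ℕ} {m : ℕ → ℕ} (hB : 1 ≤ B)
    (hr : ∀ v ∈ [n, p, K, P, r9, D, g, 3], v < 2 ^ B) (hm : ∀ i, m i < 2 ^ B) (hN : N ≤ D)
    (hD : 0 < D) (h4 : 4 ^ p * D < 2 ^ B) :
    Runs (.loop 3 sqrtBody) (regs n p K p P r9 (N / D) 1 N D g m)
      (regs n p K 0 P r9 (sqrtDigits N D p) (2 ^ p) (4 ^ p * N) D g m)
      (loopFactor sqrtBody p * B) := by
  have h := runs_loop (a := 3) hB (P := sqrtBody) rfl p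
    (fun i => regs n p K (p - i) P r9 (sqrtDigits N D i) (2 ^ i) (4 ^ i * N) D g m)
    (fun i hi => regs_bounded ?_ hm) (fun i hi => ?_) (fun i hi => (Nat.sub_pos_of_lt hi).ne')
    (Nat.sub_self p)
  · simpa [sqrtDigits] using h
  · have h1 := sqrtDigits_le hN hD i
    have h2 : 2 ^ i ≤ 4 ^ p := (Nat.pow_le_pow_left (by norm_num) i).trans
      (Nat.pow_le_pow_right (by norm_num) hi)
    have h3 : 4 ^ i * N ≤ 4 ^ p * D :=
      Nat.mul_le_mul (Nat.pow_le_pow_right (by norm_num) hi) hN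
    have h5 : 4 ^ p ≤ 4 ^ p * D := Nat.le_mul_of_pos_right _ hD
    simp only [List.forall_mem_cons, List.not_mem_nil, false_imp_iff, implies_true,
      and_true] at hr ⊢
    obtain ⟨hr1, hr2, hr3, hr4, hr5, hr6, hr7, hr8⟩ := hr
    exact ⟨hr1, hr2, hr3, (Nat.sub_le _ _).trans_lt hr2, hr4, hr5, by omega, by omega, by omega,
      hr6, hr7, hr8⟩
  · rw [show p - i = p - (i + 1) + 1 by omega, eval_sqrtBody, pow_succ' 2, pow_succ' 4, mul_assoc 4]
    rfl

theorem runs_walk {B n p K A : ℕ} {m : ℕ → ℕ} (hB : 1 ≤ B) (hn : 1 ≤ n)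
    (hr : ∀ v ∈ [n, p, K, A + n, 3], v < 2 ^ B) (hm : ∀ i, m i < 2 ^ B) (hD : n ^ n < 2 ^ B) :
    Runs (.loop 3 walkBody) ((Walk.mk 1 (1 - m 0) 1 1 0).regs n p K (n - 1) A 1 m)
      ((walk (fun i => m (A + i)) m (n - 1)).regs n p K 0 (A + (n - 1)) n m)
      (loopFactor walkBody (n - 1) * B) := by
  have h := runs_loop (a := 3) hB (P := walkBody) rfl (n - 1)
    (fun i => (walk (fun i => m (A + i)) m i).regs n p K (n - 1 - i) (A + i) (i + 1) m)
    (fun i hi => regs_bounded ?_ hm) (fun i hi => ?_) (fun i hi => (Nat.sub_pos_of_lt hi).ne')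
    (Nat.sub_self _)
  · simpa [walk, Nat.sub_add_cancel hn] using h
  · have h1 := walk_a_le (fun i => m (A + i)) m i
    have h2 := walk_k_le (fun i => m (A + i)) m i
    have h3 := walk_D_le (fun i => m (A + i)) m (by omega : i < n)
    have h4 := walk_valid (fun i => m (A + i)) m i
    have h5 := h4.N_le
    have h6 := h4.g_le
    have h7 : n ^ i ≤ n ^ n := Nat.pow_le_pow_right hn (by omega)
    simp only [List.forall_mem_cons, List.not_mem_nil, false_imp_iff, implies_true,
      and_true] at hr ⊢
    obtain ⟨hr1, hr2, hr3, hr4, hr5⟩ := hr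
    exact ⟨hr1, hr2, hr3, by omega, by omega, by omega, by omega, by omega, by omega, by omega,
      by omega, hr5⟩
  · rw [show n - 1 - i = n - 1 - (i + 1) + 1 by omega, eval_walkBody]
    rfl

/-! ### The memory that holds an input -/

theorem inputMem_fin {K : ℕ} (x : Fin K → Bool) (d : List ℕ) (i : Fin K) :
    inputMem x d i = (x i).toNat := by
  rw [inputMem, List.getD_append _ _ _ _ (by simp)]
  simp [List.getD]

theorem inputMem_add {K : ℕ} (x : Fin K → Bool) (d : List ℕ) (i : ℕ) :
    inputMem x d (K + i) = d.getD i 0 := by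
  rw [inputMem, List.getD_append_right _ _ _ _ (by simp)]
  simp

theorem layout_inputMem {n : ℕ} (x : Fin n → Bool) (d : List ℕ) :
    layout x (inputMem x d) = inputMem x d := by
  funext i
  unfold layout
  split
  · next h => exact (inputMem_fin x d ⟨i, h⟩).symm
  · rfl

variable {q : Polynomial ℕ}

theorem Toffoli.code_lt {n : ℕ} (g : Toffoli n) : ∀ v ∈ g.code, v < n := by
  simp [Toffoli.code]

theorem SchurData.desc_lt (D : SchurData q) {B : ℕ} (hB : 1 ≤ B) (hn : D.n < 2 ^ B)
    (hg : D.circuit.length < 2 ^ B) : ∀ v ∈ D.desc, v < 2 ^ B := by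
  have h2 : 2 ≤ 2 ^ B := by simpa using Nat.pow_le_pow_right two_pos hB
  have hk := D.k.isLt
  have ha := D.path.le
  intro v hv
  simp only [desc, List.mem_append, List.mem_cons, List.not_mem_nil, or_false,
    List.mem_flatMap] at hv
  rcases hv with ((rfl | rfl) | hv) | ⟨g, _, hv⟩
  · omega
  · exact hg
  · have := D.path.steps_le_one v hv; omega
  · exact (g.code_lt v hv).trans hn

theorem SchurData.inputMem_lt (D : SchurData q) {K : ℕ} (x : Fin K → Bool) {B : ℕ} (hB : 1 ≤ B)
    (hn : D.n < 2 ^ B) (hg : D.circuit.length < 2 ^ B) (i : ℕ) : inputMem x D.desc i < 2 ^ B := by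
  rcases lt_or_ge i K with hi | hi
  · rw [inputMem_fin x D.desc ⟨i, hi⟩]
    exact toNat_lt_two_pow hB _
  · obtain ⟨i, rfl⟩ := Nat.exists_eq_add_of_le hi
    rw [inputMem_add, List.getD]
    rcases h : D.desc[i]? with _ | v
    · simp
    · exact D.desc_lt hB hn hg v (List.mem_of_getElem? h)

theorem SchurData.inputMem_k (D : SchurData q) {K : ℕ} (x : Fin K → Bool) :
    inputMem x D.desc K = D.k := by
  simpa [desc] using inputMem_add x D.desc 0

theorem SchurData.inputMem_length (D : SchurData q) {K : ℕ} (x : Fin K → Bool) :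
    inputMem x D.desc (K + 1) = D.circuit.length := by
  simp [inputMem_add, desc]

theorem SchurData.inputMem_step (D : SchurData q) {K : ℕ} (x : Fin K → Bool) {i : ℕ}
    (hi : i < D.n - 1) : inputMem x D.desc (K + 2 + i) = D.path.steps.getD i 0 := by
  rw [add_assoc, add_comm 2 i, inputMem_add]
  simp only [desc, List.cons_append, List.nil_append, List.getD_cons_succ]
  exact List.getD_append _ _ _ _ (by rwa [D.path.length_steps])

theorem SchurData.coded (D : SchurData q) {K : ℕ} (x : Fin K → Bool) :
    Coded D.circuit (K + D.n + 1) (inputMem x D.desc) := by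
  refine coded_of_getD _ _ _ fun i => ?_
  have hn := D.path.one_le
  rw [show K + D.n + 1 + i = K + (D.n - 1 + i + 1 + 1) by omega, inputMem_add]
  simp only [desc, List.cons_append, List.nil_append, List.getD_cons_succ]
  rw [List.getD_append_right _ _ _ _ (by rw [D.path.length_steps]; omega), D.path.length_steps]
  simp

/-! ### The amplitudes -/

theorem SchurData.state_apply (D : SchurData q) (y : Fin D.n → Bool) :
    D.state y = D.path.amp D.k (circuitFun D.circuit.reverse y) :=
  circuitOp_mulVec _ _ _

theorem SchurData.amp_eq_walk (D : SchurData q) (x : Fin D.n → Bool) (m : ℕ → ℕ)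
    (hs : ∀ i < D.n - 1, m (D.n + 2 + i) = D.path.steps.getD i 0)
    (hx : ∀ i : Fin D.n, m i = (x i).toNat) :
    D.path.amp D.k x =
      if (walk (fun i => m (D.n + 2 + i)) m (D.n - 1)).k = D.k then
        (walk (fun i => m (D.n + 2 + i)) m (D.n - 1)).value else 0 :=
  (walk_spec D.path x _ m hs hx).2 D.k (Nat.lt_succ_iff.1 D.k.isLt)

/-- With the numerator replaced by 0 when `k` is wrong, both cases have the target `(-1)^g √(N/D)`.
The sign is encoded by which of two subtracted registers holds the digits, and it does not affect
the norm of the error. -/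
theorem norm_outComplex_sub_value_le (w : Walk) (hw : w.Valid) (p c : ℕ) (l : List ℕ)
    (m : ℕ → ℕ) :
    ‖(storeOf ((if w.g = 0 then sqrtDigits (if w.k = c then w.N else 0) w.D p else 0) ::
      (if w.g = 0 then 0 else sqrtDigits (if w.k = c then w.N else 0) w.D p) :: 0 :: 0 :: 2 ^ p :: l)
        m).outComplex - (if w.k = c then w.value else 0)‖ ≤ (2 ^ p : ℝ)⁻¹ := by
  set N := if w.k = c then w.N else 0 with hN
  have hND : N ≤ w.D := by
    rw [hN]; split_ifs
    · exact hw.N_le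
    · exact Nat.zero_le _
  have hv : (if w.k = c then w.value else 0) = (-1) ^ w.g * (√((N : ℝ) / w.D) : ℝ) := by
    rw [hN]; split_ifs
    · rfl
    · simp
  have key : (storeOf ((if w.g = 0 then sqrtDigits N w.D p else 0) ::
      (if w.g = 0 then 0 else sqrtDigits N w.D p) :: 0 :: 0 :: 2 ^ p :: l) m).outComplex =
        (-1) ^ w.g * (((sqrtDigits N w.D p : ℝ) / 2 ^ p : ℝ) : ℂ) := by
    have hg := hw.g_le
    rcases Nat.le_one_iff_eq_zero_or_eq_one.1 hg with h | h <;>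
      simp [Store.outComplex, h, neg_div]
  rw [hv, key, ← mul_sub, ← Complex.ofReal_sub, norm_mul, norm_pow, norm_neg, norm_one, one_pow,
    one_mul, Complex.norm_real]
  exact abs_sqrtDigits_sub_le hND hw.D_pos p

/-- A bound for the number of bits of the numbers that occur in the computation of amplitudes. -/
def amplitudeBits (n p g : ℕ) : ℕ := n * n + 3 * p + 2 * n + 3 * g + 6

/-- A bound for the cost per bit of the computation of amplitudes. -/
def amplitudeFactor (n p g : ℕ) : ℕ :=
  (Prog.block [constProg, gatesEndProg]).costFactor + (loopFactor gateBackwardBody g +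
    (walkInitProg.costFactor + (loopFactor walkBody n + (sqrtInitProg.costFactor +
      (loopFactor sqrtBody p + outputProg.costFactor)))))

theorem runs_amplitudeProg (D : SchurData q) (p : ℕ) (y : Fin D.n → Bool) :
    ∃ s, Runs amplitudeProg (initialStore D.n p y D.desc) s
        (amplitudeFactor D.n p D.circuit.length * amplitudeBits D.n p D.circuit.length) ∧
      0 < s.reg 4 ∧ ‖s.outComplex - D.state y‖ ≤ (2 ^ p : ℝ)⁻¹ := by
  revert y
  set n := D.n
  intro y
  set g := D.circuit.length with hg
  set B := amplitudeBits n p g with hBdef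
  have hn : 1 ≤ n := D.path.one_le
  have hB : 1 ≤ B := by rw [hBdef, amplitudeBits]; omega
  have hsmall : ∀ v, v ≤ 3 * p + 2 * n + 3 * g + 6 → v < 2 ^ B := fun v hv =>
    Nat.lt_two_pow_self.trans_le
      (Nat.pow_le_pow_right two_pos (by rw [hBdef, amplitudeBits]; omega))
  -- From `n ≤ 2^n`. This accounts for `n * n` and `2 * p` in `amplitudeBits`; the other terms leave
  -- room for counters and addresses.
  have hbig : 4 ^ p * n ^ n < 2 ^ B := by
    calc 4 ^ p * n ^ n ≤ (2 ^ 2) ^ p * (2 ^ n) ^ n :=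
          Nat.mul_le_mul le_rfl (Nat.pow_le_pow_left Nat.lt_two_pow_self.le n)
      _ = 2 ^ (2 * p + n * n) := by rw [← pow_mul, ← pow_mul, ← pow_add]
      _ < 2 ^ B := Nat.pow_lt_pow_right one_lt_two (by rw [hBdef, amplitudeBits]; omega)
  have hnn : n ^ n < 2 ^ B :=
    (Nat.le_mul_of_pos_left _ (by positivity)).trans_lt hbig
  have hm0 := D.inputMem_lt y hB (hsmall _ (by omega)) (hsmall _ (by omega))
  set x := circuitFun D.circuit.reverse y with hx
  set m := layout x (inputMem y D.desc) with hm
  have hmlt : ∀ i, m i < 2 ^ B := layout_lt hB x hm0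
  have hm_ge : ∀ {i}, n ≤ i → m i = inputMem y D.desc i := fun h => layout_of_le x _ h
  set w := walk (fun i => m (n + 2 + i)) m (n - 1) with hw
  have hwv : w.Valid := walk_valid _ _ _
  have hwD : w.D ≤ n ^ (n - 1) := walk_D_le _ _ (by omega)
  have hwD' : w.D ≤ n ^ n := hwD.trans (Nat.pow_le_pow_right hn (by omega))
  have hwa : w.a ≤ n := (walk_a_le _ _ _).trans (by omega)
  have hwk : w.k ≤ n := (walk_k_le _ _ _).trans (by omega)
  have hwN := hwv.N_le
  have hwg := hwv.g_le
  have hmk : m n = D.k := by rw [hm_ge le_rfl, D.inputMem_k]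
  set N := if w.k = m n then w.N else 0 with hN
  have hND : N ≤ w.D := by rw [hN]; split_ifs <;> omega
  have h3 := hsmall 3 (by omega)
  have h4D : 4 ^ p * w.D < 2 ^ B := (Nat.mul_le_mul_left _ hwD').trans_lt hbig
  have hr1 := (Prog.block [constProg, gatesEndProg]).runs_eval hB
    (initialStore n p y D.desc) rfl (by
      rw [initialStore_eq]
      refine storeOf_bounded ?_ hm0
      have := hsmall n (by omega)
      have := hsmall p (by omega)
      simp only [List.forall_mem_cons, List.not_mem_nil, false_imp_iff, implies_true, and_true]
      omega)
  rw [initialStore_eq, eval_gatesEndProg, D.inputMem_length, ← hg] at hr1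
  have hr2 := runs_gateBackward (n := n) (p := p) (K := n) (r9 := 0) (r10 := 0) (r11 := 0)
    (r12 := 0) (r13 := 0) (r14 := 0) hB
    (by
      have := hsmall n (by omega)
      have := hsmall p (by omega)
      simp only [List.forall_mem_cons, List.not_mem_nil, false_imp_iff, implies_true, and_true]
      omega) hm0 (by omega) D.circuit y (D.coded y) (hsmall _ (by omega))
  rw [layout_inputMem] at hr2
  have hr3 := walkInitProg.runs_eval hB _ rfl (regs_bounded (n := n) (p := p) (K := n) (c := 0)
    (P := n + n + 1) (r9 := 0) (r10 := 0) (r11 := 0) (r12 := 0) (r13 := 0) (r14 := 0) (by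
      have := hsmall n (by omega)
      have := hsmall p (by omega)
      have := hsmall (n + n + 1) (by omega)
      simp only [List.forall_mem_cons, List.not_mem_nil, false_imp_iff, implies_true, and_true]
      omega) hmlt)
  rw [eval_walkInitProg] at hr3
  have hr4 := runs_walk (p := p) (K := n) (A := n + 2) hB hn (by
      have := hsmall n (by omega)
      have := hsmall p (by omega)
      have := hsmall (n + 2 + n) (by omega)
      simp only [List.forall_mem_cons, List.not_mem_nil, false_imp_iff, implies_true, and_true]
      omega) hmlt hnn
  have hr5 := sqrtInitProg.runs_eval hB (w.regs n p n 0 (n + 2 + (n - 1)) n m) rfl (regs_bounded (by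
      have := hsmall n (by omega)
      have := hsmall p (by omega)
      have := hsmall (n + 2 + (n - 1)) (by omega)
      have := hsmall w.a (by omega)
      have := hsmall w.k (by omega)
      have := hsmall w.g (by omega)
      have : w.N < 2 ^ B := by omega
      have : w.D < 2 ^ B := by omega
      simp only [List.forall_mem_cons, List.not_mem_nil, false_imp_iff, implies_true, and_true]
      omega) hmlt)
  rw [eval_sqrtInitProg, ← hN] at hr5
  have hr6 := runs_sqrt (n := n) (p := p) (K := n) (P := n + 2 + (n - 1)) (r9 := n) (g := w.g) hB
    (by
      have := hsmall n (by omega)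
      have := hsmall p (by omega)
      have := hsmall (n + 2 + (n - 1)) (by omega)
      have := hsmall w.g (by omega)
      have : w.D < 2 ^ B := by omega
      simp only [List.forall_mem_cons, List.not_mem_nil, false_imp_iff, implies_true, and_true]
      omega) hmlt hND hwv.D_pos h4D
  have hsq := sqrtDigits_le hND hwv.D_pos p
  have hr7 := outputProg.runs_eval hB _ rfl (regs_bounded (n := n) (p := p) (K := n) (c := 0)
    (P := n + 2 + (n - 1)) (r9 := n) (r10 := sqrtDigits N w.D p) (r11 := 2 ^ p)
    (r12 := 4 ^ p * N) (r13 := w.D) (r14 := w.g) (by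
      have := hsmall n (by omega)
      have := hsmall p (by omega)
      have := hsmall (n + 2 + (n - 1)) (by omega)
      have := hsmall w.g (by omega)
      have : w.D < 2 ^ B := by omega
      have : 4 ^ p * N < 2 ^ B := (Nat.mul_le_mul_left _ hND).trans_lt h4D
      have : 2 ^ p < 2 ^ B := Nat.pow_lt_pow_right one_lt_two (by rw [hBdef, amplitudeBits]; omega)
      have : sqrtDigits N w.D p < 2 ^ B := hsq.trans_lt this
      simp only [List.forall_mem_cons, List.not_mem_nil, false_imp_iff, implies_true, and_true]
      omega) hmlt)
  rw [eval_outputProg] at hr7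
  rw [initialStore_eq]
  refine ⟨_, (hr1.seq (hr2.seq (hr3.seq (hr4.seq (hr5.seq (hr6.seq hr7)))))).mono ?_, ?_, ?_⟩
  -- The walk has `n - 1` rounds; counting `n` avoids a truncated subtraction in the final
  -- polynomial.
  · have : loopFactor walkBody (n - 1) ≤ loopFactor walkBody n := by
      unfold loopFactor; gcongr; omega
    rw [amplitudeFactor]
    simp only [add_mul]
    gcongr
  · simp
  · rw [D.state_apply, D.amp_eq_walk x m (fun i hi => ?_) (fun i => layout_fin x _ i)]
    · have := norm_outComplex_sub_value_le w hwv p D.k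
      rw [← hmk] at this ⊢
      exact this _ _
    · rw [hm_ge (by omega), D.inputMem_step y hi]

/-! ### Sampling with a uniform random number -/

/-- The bit string on which the fraction `N / D` falls when the unit interval is divided
according to the distribution of `|J, -J + k⟩`. -/
def SpinPath.sample : {n a : ℕ} → SpinPath n a → ℕ → ℕ → ℕ → (Fin n → Bool)
  | _, _, .one, k, _, _ => fun _ => decide (k = 0)
  | _, _, .up (n := n) (a := a) P, k, N, D =>
    if N * (a + 1) < k * D then
      Fin.snoc (α := fun _ : Fin (n + 1) => Bool) (P.sample (k - 1) (N * (a + 1)) (D * k)) false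
    else
      Fin.snoc (α := fun _ : Fin (n + 1) => Bool)
        (P.sample k (N * (a + 1) - k * D) (D * (a + 1 - k))) true
  | _, _, .down (n := n) (a := a) P, k, N, D =>
    if N * (a + 2) < (a + 1 - k) * D then
      Fin.snoc (α := fun _ : Fin (n + 1) => Bool)
        (P.sample k (N * (a + 2)) (D * (a + 1 - k))) false
    else
      Fin.snoc (α := fun _ : Fin (n + 1) => Bool)
        (P.sample (k + 1) (N * (a + 2) - (a + 1 - k) * D) (D * (a + 2 - (a + 1 - k)))) true

/-- The fractions `N / D` with `f N D` are those of a half-open subinterval of `[0, 1]` of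
length `w`. -/
def IsSubinterval (f : ℕ → ℕ → Prop) (w : ℝ) : Prop :=
  ∃ lo hi : ℝ, 0 ≤ lo ∧ lo ≤ hi ∧ hi ≤ 1 ∧ hi - lo = w ∧
    ∀ N D : ℕ, N < D → (f N D ↔ lo * D ≤ N ∧ N < hi * D)

theorem IsSubinterval.congr {f g : ℕ → ℕ → Prop} {w v : ℝ} (h : IsSubinterval f w)
    (hfg : ∀ N D, g N D ↔ f N D) (hwv : v = w) : IsSubinterval g v := by
  subst hwv
  obtain rfl : g = f := by ext N D; exact hfg N D
  exact h

theorem isSubinterval_false {f : ℕ → ℕ → Prop} (h : ∀ N D, N < D → ¬ f N D) :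
    IsSubinterval f 0 :=
  ⟨0, 0, le_rfl, le_rfl, zero_le_one, sub_self 0, fun N D hN =>
    ⟨fun hf => (h N D hN hf).elim, fun ⟨_, hf⟩ => by simp at hf; linarith⟩⟩

theorem isSubinterval_true {f : ℕ → ℕ → Prop} (h : ∀ N D, N < D → f N D) :
    IsSubinterval f 1 :=
  ⟨0, 1, le_rfl, zero_le_one, le_rfl, sub_zero 1, fun N D hN =>
    ⟨fun _ => ⟨by simp, by simpa using hN⟩, fun _ => h N D hN⟩⟩

/-- Multiplication by `v / u` stretches `[0, u/v)` onto `[0, 1)`, so lengths pull back with the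
factor `u / v`. For `u = 0` the part is empty. -/
theorem IsSubinterval.left {f : ℕ → ℕ → Prop} {w : ℝ} {u v : ℕ} (hv : 0 < v) (hu : u ≤ v)
    (h : 0 < u → IsSubinterval f w) :
    IsSubinterval (fun N D => N * v < u * D ∧ f (N * v) (D * u)) (u / v * w) := by
  rcases Nat.eq_zero_or_pos u with rfl | hu0
  · simpa using isSubinterval_false (f := fun N D => N * v < 0 * D ∧ f (N * v) (D * 0)) (by simp)
  obtain ⟨lo, hi, h0, hl, h1, hw, hf⟩ := h hu0
  have hv' : (0 : ℝ) < v := by exact_mod_cast hv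
  have hu' : (0 : ℝ) < u := by exact_mod_cast hu0
  have huv : (u : ℝ) / v ≤ 1 := (div_le_one hv').2 (by exact_mod_cast hu)
  refine ⟨u / v * lo, u / v * hi, by positivity, by gcongr, ?_, by rw [← mul_sub, hw], ?_⟩
  · exact mul_le_one₀ huv (h0.trans hl) h1
  intro N D hND
  have e1 : (u / v * lo * D ≤ N) ↔ lo * (D * u : ℕ) ≤ (N * v : ℕ) := by
    push_cast
    rw [show (u : ℝ) / v * lo * D = (lo * (D * u)) / v by ring, div_le_iff₀ hv']
  have e2 : ((N : ℝ) < u / v * hi * D) ↔ ((N * v : ℕ) : ℝ) < hi * (D * u : ℕ) := by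
    push_cast
    rw [show (u : ℝ) / v * hi * D = (hi * (D * u)) / v by ring, lt_div_iff₀ hv']
  rw [e1, e2]
  constructor
  · rintro ⟨hlt, hfN⟩
    exact (hf _ _ (by rwa [mul_comm D])).1 hfN
  · rintro ⟨ha, hb⟩
    -- Since `hi ≤ 1`, a rescaled number below `hi` already lies in the left part.
    have hlt : N * v < D * u := by
      have : ((N * v : ℕ) : ℝ) < (D * u : ℕ) :=
        hb.trans_le (mul_le_of_le_one_left (Nat.cast_nonneg _) h1)
      exact_mod_cast this
    exact ⟨by rwa [mul_comm u], (hf _ _ hlt).2 ⟨ha, hb⟩⟩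

theorem mul_sub_lt_mul_sub {N D u v : ℕ} (hND : N < D) (hv : 0 < v)
    (h : ¬ N * v < u * D) : N * v - u * D < D * (v - u) := by
  have h1 : N * v < D * v := Nat.mul_lt_mul_of_pos_right hND hv
  rw [Nat.mul_sub, mul_comm u]
  rw [mul_comm u] at h
  omega

/-- The stretching map is `t ↦ (v t - u) / (v - u)`. Nothing is required of `f` when `u = v`: for a
step up this is the case `k = a + 1`, in which the shorter state does not exist. -/
theorem IsSubinterval.right {f : ℕ → ℕ → Prop} {w : ℝ} {u v : ℕ} (hv : 0 < v) (hu : u ≤ v)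
    (h : u < v → IsSubinterval f w) :
    IsSubinterval (fun N D => ¬ N * v < u * D ∧ f (N * v - u * D) (D * (v - u)))
      ((v - u : ℕ) / v * w) := by
  rcases hu.eq_or_lt with rfl | huv
  · have := isSubinterval_false
      (f := fun N D => ¬ N * u < u * D ∧ f (N * u - u * D) (D * (u - u)))
      (fun N D hND hf => hf.1 (by rw [mul_comm]; exact Nat.mul_lt_mul_of_pos_left hND hv))
    simpa using this
  obtain ⟨lo, hi, h0, hl, h1, hw, hf⟩ := h huv
  have hv' : (0 : ℝ) < v := by exact_mod_cast hv
  have hu' : (u : ℝ) < v := by exact_mod_cast huv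
  have hvu : ((v - u : ℕ) : ℝ) = v - u := Nat.cast_sub hu
  have hpos : (0 : ℝ) < v - u := by linarith
  refine ⟨(u + (v - u) * lo) / v, (u + (v - u) * hi) / v, by positivity, by gcongr, ?_, ?_, ?_⟩
  · rw [div_le_one hv']; nlinarith
  · rw [hvu, ← hw]; field_simp; ring
  intro N D hND
  rw [show (u + (v - u) * lo) / v * (D : ℝ) = (u * D + lo * (D * (v - u))) / v by ring,
    show (u + (v - u) * hi) / v * (D : ℝ) = (u * D + hi * (D * (v - u))) / v by ring,
    div_le_iff₀ hv', lt_div_iff₀ hv']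
  have hD : (0 : ℝ) ≤ D := Nat.cast_nonneg D
  constructor
  · rintro ⟨hlt, hfN⟩
    obtain ⟨ha, hb⟩ := (hf _ _ (mul_sub_lt_mul_sub hND hv hlt)).1 hfN
    rw [Nat.cast_sub (not_lt.1 hlt)] at ha hb
    push_cast [hvu] at ha hb
    constructor <;> linarith
  · rintro ⟨ha, hb⟩
    have hlt : ¬ N * v < u * D := by
      have : (u * D : ℝ) ≤ N * v := le_trans (by nlinarith [mul_nonneg h0 (mul_nonneg hD hpos.le)]) ha
      exact not_lt.2 (by exact_mod_cast this)
    refine ⟨hlt, (hf _ _ (mul_sub_lt_mul_sub hND hv hlt)).2 ?_⟩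
    rw [Nat.cast_sub (not_lt.1 hlt)]
    push_cast [hvu]
    constructor <;> linarith

theorem snoc_eq_iff {n : ℕ} (y : Fin n → Bool) (b : Bool) (x : Fin (n + 1) → Bool) :
    Fin.snoc (α := fun _ : Fin (n + 1) => Bool) y b = x ↔
      b = x (Fin.last n) ∧ y = Fin.init x := by
  constructor
  · rintro rfl; simp
  · rintro ⟨rfl, rfl⟩; exact Fin.snoc_init_self x

theorem norm_sqrt_mul_sq {r : ℝ} (hr : 0 ≤ r) (z : ℂ) :
    ‖((√r : ℝ) : ℂ) * z‖ ^ 2 = r * ‖z‖ ^ 2 := by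
  rw [norm_mul, mul_pow, Complex.norm_real, Real.norm_eq_abs, sq_abs, Real.sq_sqrt hr]

/-- The squared coefficients of the bits 0 and 1 are `u / v` and `(v - u) / v`, with `u = k`, `v = a
+ 1` for a step up and `u = a + 1 - k`, `v = a + 2` for a step down. The two rescaling lemmas
multiply the length by exactly these factors. -/
theorem SpinPath.isSubinterval_sample {n a : ℕ} (P : SpinPath n a) (k : ℕ) (hk : k ≤ a)
    (x : Fin n → Bool) : IsSubinterval (fun N D => P.sample k N D = x) (‖P.amp k x‖ ^ 2) := by
  induction P generalizing k with
  | one =>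
    have hx : ∀ N D, SpinPath.one.sample k N D = x ↔ x 0 = decide (k = 0) := by
      intro N D
      rw [sample, funext_iff]
      simp [Fin.forall_fin_one, eq_comm]
    simp only [hx, amp_one]
    interval_cases k <;> cases x 0 <;>
      simp [isSubinterval_true, isSubinterval_false]
  | @up n a P ih =>
    cases hx : x (Fin.last n) with
    | false =>
      rcases k with _ | k
      · rw [amp_up_false_zero P x hx]
        refine (isSubinterval_false fun N D _ h => ?_).congr (fun _ _ => Iff.rfl) (by simp)
        simp [sample, snoc_eq_iff, hx] at h
      · refine (IsSubinterval.left (u := k + 1) (v := a + 1) (Nat.succ_pos a) hk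
          (fun _ => ih k (by omega) (Fin.init x))).congr (fun N D => ?_) ?_
        · simp only [sample]
          split_ifs with h <;> simp [snoc_eq_iff, hx, h]
        · rw [amp_up_false_succ P k x hx, norm_sqrt_mul_sq (by positivity)]
          push_cast; rfl
    | true =>
      refine (IsSubinterval.right (u := k) (v := a + 1) (Nat.succ_pos a) hk
        (fun h => ih k (by omega) (Fin.init x))).congr (fun N D => ?_) ?_
      · simp only [sample]
        split_ifs with h <;> simp [snoc_eq_iff, hx, h]
      · have h' : (0 : ℝ) ≤ a + 1 - k := by
          have : (k : ℝ) ≤ a + 1 := by exact_mod_cast hk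
          linarith
        rw [amp_up_true P k x hx, norm_sqrt_mul_sq (by positivity), Nat.cast_sub hk]
        push_cast; rfl
  | @down n a P ih =>
    cases hx : x (Fin.last n) with
    | false =>
      refine (IsSubinterval.left (u := a + 1 - k) (v := a + 2) (Nat.succ_pos _) (by omega)
        (fun _ => ih k (by omega) (Fin.init x))).congr (fun N D => ?_) ?_
      · simp only [sample]
        split_ifs with h <;> simp [snoc_eq_iff, hx, h]
      · have h' : (0 : ℝ) ≤ a + 1 - k := by
          have : (k : ℝ) ≤ a := by exact_mod_cast hk
          linarith
        rw [amp_down_false P k x hx, neg_mul, norm_neg, norm_sqrt_mul_sq (by positivity),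
          Nat.cast_sub (by omega)]
        push_cast; rfl
    | true =>
      refine (IsSubinterval.right (u := a + 1 - k) (v := a + 2) (Nat.succ_pos _) (by omega)
        (fun _ => ih (k + 1) (by omega) (Fin.init x))).congr (fun N D => ?_) ?_
      · simp only [sample]
        split_ifs with h <;> simp [snoc_eq_iff, hx, h]
      · rw [amp_down_true P k x hx, norm_sqrt_mul_sq (by positivity),
          show a + 2 - (a + 1 - k) = k + 1 by omega]
        push_cast; rfl

/-- The count is a difference of two ceilings, each less than 1 above its argument; `hi ≤ 1` keeps
the counted integers below `D`. -/
theorem IsSubinterval.abs_card_sub_le {f : ℕ → ℕ → Prop} {w : ℝ} (h : IsSubinterval f w) (D : ℕ)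
    [DecidablePred fun N => f N D] :
    |(((Finset.range D).filter fun N => f N D).card : ℝ) - w * D| ≤ 1 := by
  obtain ⟨lo, hi, h0, hl, h1, rfl, hf⟩ := h
  have hD : (0 : ℝ) ≤ D := Nat.cast_nonneg D
  have hle : ⌈lo * D⌉₊ ≤ ⌈hi * D⌉₊ := Nat.ceil_mono (by gcongr)
  have heq : (Finset.range D).filter (fun N => f N D) = Finset.Ico ⌈lo * D⌉₊ ⌈hi * D⌉₊ := by
    ext N
    simp only [Finset.mem_filter, Finset.mem_range, Finset.mem_Ico, Nat.ceil_le, Nat.lt_ceil]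
    constructor
    · rintro ⟨hN, h⟩
      exact (hf N D hN).1 h
    · rintro ⟨ha, hb⟩
      have hN : N < D := by
        have : (N : ℝ) < D := hb.trans_le (mul_le_of_le_one_left hD h1)
        exact_mod_cast this
      exact ⟨hN, (hf N D hN).2 ⟨ha, hb⟩⟩
  rw [heq, Nat.card_Ico, Nat.cast_sub hle, abs_le]
  have a1 := Nat.le_ceil (lo * (D : ℝ))
  have a2 := Nat.ceil_lt_add_one (mul_nonneg h0 hD)
  have b1 := Nat.le_ceil (hi * (D : ℝ))
  have b2 := Nat.ceil_lt_add_one (mul_nonneg (h0.trans hl) hD)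
  constructor <;> nlinarith

theorem ofBits_injective (K : ℕ) : Function.Injective (Nat.ofBits : (Fin K → Bool) → ℕ) := by
  intro f g h
  funext i
  rw [← Nat.testBit_ofBits_lt f i i.isLt, h, Nat.testBit_ofBits_lt g i i.isLt]

theorem image_ofBits (K : ℕ) :
    Finset.univ.image (Nat.ofBits : (Fin K → Bool) → ℕ) = Finset.range (2 ^ K) := by
  refine Finset.eq_of_subset_of_card_le (fun N hN => ?_) ?_
  · obtain ⟨f, _, rfl⟩ := Finset.mem_image.1 hN
    exact Finset.mem_range.2 (Nat.ofBits_lt_two_pow f)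
  · rw [Finset.card_image_of_injective _ (ofBits_injective K)]
    simp

/-- Binary expansion is a bijection, so fair bits give a uniformly distributed integer. -/
theorem card_filter_ofBits (K : ℕ) (S : ℕ → Prop) [DecidablePred S] :
    (Finset.univ.filter fun r : Fin K → Bool => S (Nat.ofBits r)).card =
      ((Finset.range (2 ^ K)).filter S).card := by
  rw [← image_ofBits, Finset.filter_image, Finset.card_image_of_injective _ (ofBits_injective K)]

theorem sum_mul_two_pow_eq_ofBits {K : ℕ} (r : Fin K → Bool) (m : ℕ → ℕ)
    (hm : ∀ i : Fin K, m i = (r i).toNat) :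
    ∑ i ∈ Finset.range K, m i * 2 ^ i = Nat.ofBits r := by
  induction K generalizing m with
  | zero => simp
  | succ K ih =>
    have h := ih (r ∘ Fin.succ) (fun i => m (i + 1)) (fun i => hm i.succ)
    rw [Finset.sum_range_succ', Nat.ofBits_succ, ← h, Finset.mul_sum, ← hm 0]
    simp only [pow_succ, pow_zero, mul_one, Fin.val_zero, add_left_inj]
    exact Finset.sum_congr rfl fun i _ => by ring

/-! ### The sampling algorithm -/

theorem layout_snoc {n : ℕ} (x : Fin n → Bool) (b : Bool) (m : ℕ → ℕ) :
    layout (Fin.snoc (α := fun _ : Fin (n + 1) => Bool) x b) m =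
      layout x (Function.update m n b.toNat) := by
  funext i
  rcases lt_trichotomy i n with h | rfl | h
  · simp [layout, h, h.trans (Nat.lt_succ_self n), Fin.snoc]
  · simp [layout, Fin.snoc]
  · have h1 : ¬ i < n := by omega
    have h2 : ¬ i < n + 1 := by omega
    simp [layout, h1, h2, h.ne']

theorem runs_bits {B n p K : ℕ} {m : ℕ → ℕ} (hB : 1 ≤ B)
    (hr : ∀ v ∈ [n, p, K, 3], v < 2 ^ B) (hm : ∀ i, m i < 2 ^ B) (hK : K < B)
    (h01 : ∀ i < K, m i ≤ 1) :
    Runs (.loop 3 bitsBody) (regs n p K K 0 0 0 0 0 1 0 m)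
      (regs n p K 0 K 0 0 0 (∑ i ∈ Finset.range K, m i * 2 ^ i) (2 ^ K) 0 m)
      (loopFactor bitsBody K * B) := by
  have h := runs_loop (a := 3) hB (P := bitsBody) rfl K
    (fun i => regs n p K (K - i) i 0 0 0 (∑ j ∈ Finset.range i, m j * 2 ^ j) (2 ^ i) 0 m)
    (fun i hi => regs_bounded ?_ hm) (fun i hi => ?_) (fun i hi => (Nat.sub_pos_of_lt hi).ne')
    (Nat.sub_self K)
  · simpa using h
  · have h1 : ∀ i ≤ K, ∑ j ∈ Finset.range i, m j * 2 ^ j < 2 ^ i := by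
      intro i
      induction i with
      | zero => simp
      | succ i ih =>
        intro hi
        have := ih (by omega)
        have := Nat.mul_le_mul_right (2 ^ i) (h01 i hi)
        rw [Finset.sum_range_succ, pow_succ]
        omega
    have h2 := h1 i hi
    have h3 : 2 ^ i < 2 ^ B := Nat.pow_lt_pow_right one_lt_two (by omega)
    simp only [List.forall_mem_cons, List.not_mem_nil, false_imp_iff, implies_true,
      and_true] at hr ⊢
    omega
  · rw [show K - i = K - (i + 1) + 1 by omega, eval_bitsBody, Finset.sum_range_succ, pow_succ' 2]

theorem SpinPath.runs_spin {B n0 p K A r12 r13 n a : ℕ} (P : SpinPath n a) {m : ℕ → ℕ}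
    (hB : 1 ≤ B) (hr : ∀ v ∈ [n0, p, K, A + n, r12, r13, 3], v < 2 ^ B) (hm : ∀ i, m i < 2 ^ B)
    (hs : ∀ i < n - 1, m (A + i) = P.steps.getD i 0) :
    Runs (.loop 3 spinBody) (regs n0 p K (n - 1) A 0 1 0 r12 r13 0 m)
      (regs n0 p K 0 (A + (n - 1)) 0 a 0 r12 r13 0 m) (loopFactor spinBody (n - 1) * B) := by
  have h := runs_loop (a := 3) hB (P := spinBody) rfl (n - 1)
    (fun i => regs n0 p K (n - 1 - i) (A + i) 0 (walk (fun i => m (A + i)) 0 i).a 0 r12 r13 0 m)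
    (fun i hi => regs_bounded ?_ hm) (fun i hi => ?_) (fun i hi => (Nat.sub_pos_of_lt hi).ne')
    (Nat.sub_self _)
  -- The spin component of a walk does not depend on the bits, so the zero string serves.
  · have ha : (walk (fun i => m (A + i)) 0 (n - 1)).a = a :=
      (walk_spec P (fun _ => false) _ _ hs (fun _ => rfl)).1
    simpa only [ha, Nat.sub_self, Nat.sub_zero, add_zero, walk] using h
  · have h1 := walk_a_le (fun i => m (A + i)) 0 i
    have hn := P.one_le
    simp only [List.forall_mem_cons, List.not_mem_nil, false_imp_iff, implies_true,
      and_true] at hr ⊢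
    omega
  · rw [show n - 1 - i = n - 1 - (i + 1) + 1 by omega, eval_spinBody]
    simp only [walk, Walk.next, Pi.zero_apply, if_true]
    split_ifs <;> rfl

theorem sample_regs_bounded {B Z n0 p K A n a k N D : ℕ} {m : ℕ → ℕ} (hZ : n < Z)
    (hr : ∀ v ∈ [n0, p, K, A + n, Z, 3], v < 2 ^ B) (ha : a ≤ n) (hk : k ≤ a) (hND : N < D)
    (hD : D * Z ^ (n - 1) < 2 ^ B) (hm : ∀ i, m i < 2 ^ B) :
    (regs n0 p K (n - 1) (A + (n - 1)) 0 a k N D 0 m).Bounded B := by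
  refine regs_bounded ?_ hm
  have hD1 : D < 2 ^ B := (Nat.le_mul_of_pos_right _ (Nat.pow_pos (by omega))).trans_lt hD
  simp only [List.forall_mem_cons, List.not_mem_nil, false_imp_iff, implies_true,
    and_true] at hr ⊢
  omega

theorem update_lt {B : ℕ} (hB : 1 ≤ B) {m : ℕ → ℕ} (hm : ∀ i, m i < 2 ^ B) (j : ℕ) (b : Bool)
    (i : ℕ) : Function.update m j b.toNat i < 2 ^ B := by
  by_cases hi : i = j
  · subst hi; rw [Function.update_self]; exact toNat_lt_two_pow hB b
  · rw [Function.update_of_ne hi]; exact hm i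

theorem mul_mul_pow_lt {D u Z n X : ℕ} (hu : u ≤ Z) (hD : D * Z ^ (n + 1) < X) :
    D * u * Z ^ n < X := by
  refine lt_of_le_of_lt ?_ hD
  rw [pow_succ', mul_assoc]
  gcongr

/-- `Z` stays fixed while `n` decreases. Each step multiplies `D` by at most `Z`, so `D * Z^(n-1)`
never increases and its initial value bounds all denominators. The sampled bits only overwrite cells
below `n ≤ A`, which keeps the steps of the path readable. -/
theorem SpinPath.runs_sample {B Z n0 p K A n a : ℕ} (P : SpinPath n a) (hB : 1 ≤ B) (hZ : n < Z)
    (hr : ∀ v ∈ [n0, p, K, A + n, Z, 3], v < 2 ^ B) (hA : n ≤ A) (k N D : ℕ) (hk : k ≤ a)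
    (hND : N < D) (hD : D * Z ^ (n - 1) < 2 ^ B) (m : ℕ → ℕ) (hm : ∀ i, m i < 2 ^ B)
    (hs : ∀ i < n - 1, m (A + i) = P.steps.getD i 0) :
    ∃ (m' : ℕ → ℕ) (k' N' D' : ℕ),
      Runs (.loop 3 sampleBody) (regs n0 p K (n - 1) (A + (n - 1)) 0 a k N D 0 m)
        (regs n0 p K 0 A 0 1 k' N' D' 0 m') (loopFactor sampleBody (n - 1) * B) ∧
      (∀ v ∈ [k', N', D'], v < 2 ^ B) ∧ (∀ i, m' i < 2 ^ B) ∧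
      Function.update m' 0 (1 - k') = layout (P.sample k N D) m := by
  induction P generalizing k N D m with
  | one =>
    have hbd := sample_regs_bounded hZ hr le_rfl hk hND hD hm
    refine ⟨m, k, N, D, (runs_loop_zero hbd rfl).mono (loopFactor_zero hB _), ?_, hm, ?_⟩
    · simp only [List.forall_mem_cons, List.not_mem_nil, false_imp_iff, implies_true, and_true]
      simp only [List.forall_mem_cons] at hr
      simp only [Nat.sub_self, pow_zero, mul_one] at hD
      omega
    · funext i
      rcases i with _ | i
      · interval_cases k <;> simp [layout, sample]
      · simp [layout]
  | @up n a P ih =>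
    have hbd := sample_regs_bounded hZ hr P.up.le hk hND hD hm
    have hlen := P.one_le
    have hP := P.le
    obtain ⟨n, rfl⟩ := Nat.exists_eq_add_of_le' hlen
    have hr' : ∀ v ∈ [n0, p, K, A + (n + 1), Z, 3], v < 2 ^ B := by
      simp only [List.forall_mem_cons, List.not_mem_nil, false_imp_iff, implies_true,
        and_true] at hr ⊢
      omega
    have hstep := (hs n (by omega)).trans P.getD_steps_up_last
    have hs' : ∀ b : Bool, ∀ i < n, Function.update m (n + 1) b.toNat (A + i) =
        P.steps.getD i 0 := fun b i hi => by
      rw [Function.update_of_ne (by omega), hs i (by omega)]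
      exact P.getD_steps_up hi
    have h1 := sampleBody.runs_eval hB _ rfl hbd
    simp only [Nat.add_sub_cancel] at hbd h1 hD ⊢
    rw [← add_assoc A, eval_sampleBody_up _ _ _ _ _ _ _ _ _ _ hstep] at h1
    by_cases hlt : N * (a + 1) < k * D
    · rw [if_pos hlt] at h1
      obtain ⟨m', k', N', D', hrun, hb, hm', hup⟩ := ih (by omega) hr' (by omega) (k - 1)
        (N * (a + 1)) (D * k) (by omega) (by rwa [mul_comm D])
        (mul_mul_pow_lt (by omega) hD) _ (update_lt hB hm (n + 1) false) (hs' false)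
      refine ⟨m', k', N', D', (Runs.loop_step (a := 3) hbd (Nat.succ_ne_zero n) h1 hrun).mono
        (loopFactor_succ hB _ _), hb, hm', hup.trans ?_⟩
      rw [sample, if_pos hlt, layout_snoc]
    · rw [if_neg hlt] at h1
      -- For `k = a + 1` the bit 0 has probability 1, and this branch is not reached.
      have hk' : k ≤ a := by
        by_contra hcon
        exact hlt (by rw [show k = a + 1 by omega, mul_comm]
                      exact Nat.mul_lt_mul_of_pos_left hND (Nat.succ_pos a))
      obtain ⟨m', k', N', D', hrun, hb, hm', hup⟩ := ih (by omega) hr' (by omega) k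
        (N * (a + 1) - k * D) (D * (a + 1 - k)) hk'
        (mul_sub_lt_mul_sub hND (Nat.succ_pos a) hlt)
        (mul_mul_pow_lt (by omega) hD) _ (update_lt hB hm (n + 1) true) (hs' true)
      refine ⟨m', k', N', D', (Runs.loop_step (a := 3) hbd (Nat.succ_ne_zero n) h1 hrun).mono
        (loopFactor_succ hB _ _), hb, hm', hup.trans ?_⟩
      rw [sample, if_neg hlt, layout_snoc]
  | @down n a P ih =>
    have hbd := sample_regs_bounded hZ hr P.down.le hk hND hD hm
    have hlen := P.one_le
    have hP := P.le
    obtain ⟨n, rfl⟩ := Nat.exists_eq_add_of_le' hlen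
    have hr' : ∀ v ∈ [n0, p, K, A + (n + 1), Z, 3], v < 2 ^ B := by
      simp only [List.forall_mem_cons, List.not_mem_nil, false_imp_iff, implies_true,
        and_true] at hr ⊢
      omega
    have hstep := (hs n (by omega)).trans P.getD_steps_down_last
    have hs' : ∀ b : Bool, ∀ i < n, Function.update m (n + 1) b.toNat (A + i) =
        P.steps.getD i 0 := fun b i hi => by
      rw [Function.update_of_ne (by omega), hs i (by omega)]
      exact P.getD_steps_down hi
    have h1 := sampleBody.runs_eval hB _ rfl hbd
    simp only [Nat.add_sub_cancel] at hbd h1 hD ⊢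
    rw [← add_assoc A, eval_sampleBody_down _ _ _ _ _ _ _ _ _ _ hstep] at h1
    by_cases hlt : N * (a + 2) < (a + 1 - k) * D
    · rw [if_pos hlt] at h1
      obtain ⟨m', k', N', D', hrun, hb, hm', hup⟩ := ih (by omega) hr' (by omega) k
        (N * (a + 2)) (D * (a + 1 - k)) (by omega) (by rwa [mul_comm D])
        (mul_mul_pow_lt (by omega) hD) _ (update_lt hB hm (n + 1) false) (hs' false)
      refine ⟨m', k', N', D', (Runs.loop_step (a := 3) hbd (Nat.succ_ne_zero n) h1 hrun).mono
        (loopFactor_succ hB _ _), hb, hm', hup.trans ?_⟩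
      rw [sample, if_pos hlt, layout_snoc]
    · rw [if_neg hlt] at h1
      obtain ⟨m', k', N', D', hrun, hb, hm', hup⟩ := ih (by omega) hr' (by omega) (k + 1)
        (N * (a + 2) - (a + 1 - k) * D) (D * (a + 2 - (a + 1 - k))) (by omega)
        (mul_sub_lt_mul_sub hND (Nat.succ_pos _) hlt)
        (mul_mul_pow_lt (by omega) hD) _ (update_lt hB hm (n + 1) true) (hs' true)
      refine ⟨m', k', N', D', (Runs.loop_step (a := 3) hbd (Nat.succ_ne_zero n) h1 hrun).mono
        (loopFactor_succ hB _ _), hb, hm', hup.trans ?_⟩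
      rw [sample, if_neg hlt, layout_snoc]

/-- A bound for the number of bits of the numbers that occur in the sampling algorithm. -/
def sampleBits (n p g : ℕ) : ℕ := n * n + 3 * p + 4 * n + 3 * g + 6

/-- A bound for the cost per bit of the sampling algorithm. -/
def sampleFactor (n p g : ℕ) : ℕ :=
  bitsInitProg.costFactor + (loopFactor bitsBody (n + p) + (spinInitProg.costFactor +
    (loopFactor spinBody n + (sampleInitProg.costFactor + (loopFactor sampleBody n +
      (gatesBeginProg.costFactor + loopFactor gateForwardBody g))))))

theorem runs_sampleProg (D : SchurData q) (p : ℕ) {K : ℕ} (hK : K = D.n + p)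
    (r : Fin K → Bool) :
    ∃ s, Runs sampleProg (initialStore D.n p r D.desc) s
        (sampleFactor D.n p D.circuit.length * sampleBits D.n p D.circuit.length) ∧
      s.outBits D.n =
        circuitFun D.circuit (D.path.sample D.k (Nat.ofBits r) (2 ^ K)) := by
  set n := D.n
  set g := D.circuit.length with hg
  set B := sampleBits n p g with hBdef
  have hn : 1 ≤ n := D.path.one_le
  have ha : D.twoJ ≤ n := D.path.le
  have hk : (D.k : ℕ) ≤ D.twoJ := Nat.lt_succ_iff.1 D.k.isLt
  have hB : 1 ≤ B := by rw [hBdef, sampleBits]; omega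
  have hsmall : ∀ v, v ≤ 3 * p + 4 * n + 3 * g + 6 → v < 2 ^ B := fun v hv =>
    Nat.lt_two_pow_self.trans_le
      (Nat.pow_le_pow_right two_pos (by rw [hBdef, sampleBits]; omega))
  have hKB : K < B := by rw [hBdef, sampleBits]; omega
  have h2K : 2 ^ K < 2 ^ B := Nat.pow_lt_pow_right one_lt_two hKB
  have hbig : 2 ^ K * (n + 1) ^ (n - 1) < 2 ^ B := by
    calc 2 ^ K * (n + 1) ^ (n - 1) ≤ 2 ^ K * (2 ^ n) ^ n :=
          Nat.mul_le_mul le_rfl ((Nat.pow_le_pow_left Nat.lt_two_pow_self _).trans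
            (Nat.pow_le_pow_right (by positivity) (by omega)))
      _ = 2 ^ (K + n * n) := by rw [← pow_mul, ← pow_add]
      _ < 2 ^ B := Nat.pow_lt_pow_right one_lt_two (by rw [hBdef, sampleBits]; omega)
  have h3 := hsmall 3 (by omega)
  have hsn := hsmall n (by omega)
  have hsp := hsmall p (by omega)
  have hsK := hsmall K (by omega)
  have hsKn := hsmall (K + 2 + n) (by omega)
  set m := inputMem r D.desc with hm
  have hmlt : ∀ i, m i < 2 ^ B := D.inputMem_lt r hB hsn (hsmall _ (by omega))
  have hstep : ∀ i < n - 1, m (K + 2 + i) = D.path.steps.getD i 0 := fun i hi =>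
    D.inputMem_step r hi
  have hr1 := bitsInitProg.runs_eval hB (initialStore n p r D.desc) rfl (by
    rw [initialStore_eq]
    refine storeOf_bounded ?_ hmlt
    simp only [List.forall_mem_cons, List.not_mem_nil, false_imp_iff, implies_true, and_true]
    omega)
  rw [initialStore_eq, eval_bitsInitProg, ← hm] at hr1
  have hr2 := runs_bits (n := n) (p := p) hB (by
    simp only [List.forall_mem_cons, List.not_mem_nil, false_imp_iff, implies_true, and_true]
    omega) hmlt hKB (fun i hi => by
      rw [hm, inputMem_fin r D.desc ⟨i, hi⟩]; exact Bool.toNat_le _)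
  rw [sum_mul_two_pow_eq_ofBits r m (inputMem_fin r D.desc)] at hr2
  have hN := Nat.ofBits_lt_two_pow r
  set N := Nat.ofBits r
  have hr3 := spinInitProg.runs_eval hB (regs n p K 0 K 0 0 0 N (2 ^ K) 0 m) rfl (regs_bounded (by
    simp only [List.forall_mem_cons, List.not_mem_nil, false_imp_iff, implies_true, and_true]
    omega) hmlt)
  rw [eval_spinInitProg] at hr3
  have hr4 := D.path.runs_spin (n0 := n) (p := p) (K := K) (A := K + 2) (r12 := N) (r13 := 2 ^ K)
    hB (by
    simp only [List.forall_mem_cons, List.not_mem_nil, false_imp_iff, implies_true, and_true]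
    omega) hmlt hstep
  have hr5 := sampleInitProg.runs_eval hB
    (regs n p K 0 (K + 2 + (n - 1)) 0 D.twoJ 0 N (2 ^ K) 0 m) rfl (regs_bounded (by
    simp only [List.forall_mem_cons, List.not_mem_nil, false_imp_iff, implies_true, and_true]
    omega) hmlt)
  rw [eval_sampleInitProg, hm, D.inputMem_k, ← hm] at hr5
  obtain ⟨m', k', N', D', hr6, hb, hm', hup⟩ := D.path.runs_sample (Z := n + 1) (n0 := n) (p := p)
    (K := K) (A := K + 2) hB (Nat.lt_succ_self n) (by
    simp only [List.forall_mem_cons, List.not_mem_nil, false_imp_iff, implies_true, and_true]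
    omega) (by omega) D.k N (2 ^ K) hk hN hbig m hmlt hstep
  simp only [List.forall_mem_cons, List.not_mem_nil, false_imp_iff, implies_true, and_true] at hb
  have hr7 := gatesBeginProg.runs_eval hB (regs n p K 0 (K + 2) 0 1 k' N' D' 0 m') rfl
    (regs_bounded (by
    simp only [List.forall_mem_cons, List.not_mem_nil, false_imp_iff, implies_true, and_true]
    omega) hm')
  -- As `n ≤ K`, the sampled bits replace only random bits, already converted to `N`, and never the
  -- description.
  have hlen : m' (K + 1) = g := by
    have := congrFun hup (K + 1)
    rwa [Function.update_of_ne (Nat.succ_ne_zero K), layout_of_le _ _ (by omega), hm,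
      D.inputMem_length] at this
  rw [eval_gatesBeginProg _ _ _ _ _ _ _ _ (by omega), hup, hlen] at hr7
  have hr8 := runs_gateForward (n := n) (p := p) (K := K) (r9 := 0) (r10 := 1) (r11 := k')
    (r12 := N') (r13 := D') (r14 := 0) hB (by
    simp only [List.forall_mem_cons, List.not_mem_nil, false_imp_iff, implies_true, and_true]
    omega) hmlt (by omega) D.circuit (D.path.sample D.k N (2 ^ K)) (D.coded r)
    (hsmall _ (by omega))
  rw [initialStore_eq]
  refine ⟨_, (hr1.seq (hr2.seq (hr3.seq (hr4.seq (hr5.seq (hr6.seq (hr7.seq hr8))))))).mono ?_, ?_⟩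
  · have h4 : loopFactor spinBody (n - 1) ≤ loopFactor spinBody n := by
      unfold loopFactor; gcongr; omega
    have h5 : loopFactor sampleBody (n - 1) ≤ loopFactor sampleBody n := by
      unfold loopFactor; gcongr; omega
    rw [sampleFactor, ← hK]
    simp only [add_mul]
    gcongr
  · funext i
    simp only [Store.outBits, regs, storeOf_mem, layout_fin]
    cases circuitFun D.circuit (D.path.sample D.k N (2 ^ K)) i <;> simp

/-! ### Computational tractability -/

/-- Needed to pass from `q(n)` gates to a time bound that is a polynomial in `n + p`. -/
theorem Polynomial.eval_le_eval_nat (P : Polynomial ℕ) {x y : ℕ} (h : x ≤ y) :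
    P.eval x ≤ P.eval y := by
  rw [Polynomial.eval_eq_sum, Polynomial.eval_eq_sum]
  exact Finset.sum_le_sum fun i _ => Nat.mul_le_mul_left _ (Nat.pow_le_pow_left h i)

theorem sum_map_logCost_le {l : List ℕ} {c : ℕ} (h : ∀ v ∈ l, v ≤ c) :
    (l.map logCost).sum ≤ l.length * (c + 1) := by
  have := List.sum_le_card_nsmul (l.map logCost) (c + 1) fun x hx => by
    obtain ⟨v, hv, rfl⟩ := List.mem_map.1 hx
    exact Nat.succ_le_succ (Nat.size_le.2 (Nat.lt_two_pow_self.trans_le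
      (Nat.pow_le_pow_right two_pos (h v hv))))
  simpa using this

theorem SchurData.le_of_mem_desc (D : SchurData q) :
    ∀ v ∈ D.desc, v ≤ D.n + D.circuit.length := by
  have hk := D.k.isLt
  have ha := D.path.le
  have hn := D.path.one_le
  intro v hv
  simp only [desc, List.mem_append, List.mem_cons, List.not_mem_nil, or_false,
    List.mem_flatMap] at hv
  rcases hv with ((rfl | rfl) | hv) | ⟨g, _, hv⟩
  · omega
  · omega
  · have := D.path.steps_le_one v hv; omega
  · have := g.code_lt v hv; omega

theorem SchurData.length_desc (D : SchurData q) :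
    D.desc.length = D.n + 1 + 3 * D.circuit.length := by
  have hn := D.path.one_le
  have h : (D.circuit.flatMap Toffoli.code).length = 3 * D.circuit.length := by
    induction D.circuit with
    | nil => rfl
    | cons g C ih => simp [ih, Toffoli.code]; ring
  simp only [desc, List.length_append, h, D.path.length_steps, List.length_cons, List.length_nil]
  omega

theorem polySizeDescriptions_schur (q : Polynomial ℕ) :
    PolySizeDescriptions (ι := SchurData q) (fun D => D.n) (fun D => D.desc) := by
  refine ⟨(.X + 1 + 3 * q) * (.X + q + 1), fun D => ?_⟩
  refine (sum_map_logCost_le D.le_of_mem_desc).trans ?_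
  have := D.length_le
  rw [D.length_desc]
  simp only [Polynomial.eval_mul, Polynomial.eval_add, Polynomial.eval_X, Polynomial.eval_one,
    Polynomial.eval_ofNat]
  gcongr

theorem amplitudesPolyTime_schur (q : Polynomial ℕ) :
    AmplitudesPolyTime (ι := SchurData q) (fun D => D.n) (fun D => D.desc) (fun D => D.state) := by
  refine ⟨amplitudeProg,
    (.C (Prog.block [constProg, gatesEndProg]).costFactor +
      ((q + 1) * .C (gateBackwardBody.costFactor + 2) +
      (.C walkInitProg.costFactor + ((.X + 1) * .C (walkBody.costFactor + 2) +
      (.C sqrtInitProg.costFactor + ((.X + 1) * .C (sqrtBody.costFactor + 2) +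
      .C outputProg.costFactor)))))) * (.X * .X + 3 * .X + 2 * .X + 3 * q + 6), fun D p y => ?_⟩
  obtain ⟨s, ⟨t, ht, he⟩, h4, hs⟩ := runs_amplitudeProg D p y
  refine ⟨s, t, he, ht.trans ?_, h4, hs⟩
  have hg := D.length_le.trans (q.eval_le_eval_nat (Nat.le_add_right D.n p))
  have hn := Nat.le_add_right D.n p
  have hp := Nat.le_add_left p D.n
  simp only [Polynomial.eval_mul, Polynomial.eval_add, Polynomial.eval_X, Polynomial.eval_one,
    Polynomial.eval_ofNat, Polynomial.eval_C, amplitudeFactor, amplitudeBits, loopFactor]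
  gcongr

theorem SchurData.abs_card_sub_le (D : SchurData q) (K : ℕ) (y : Fin D.n → Bool) :
    |((Finset.univ.filter fun r : Fin K → Bool =>
        circuitFun D.circuit (D.path.sample D.k (Nat.ofBits r) (2 ^ K)) = y).card : ℝ) / 2 ^ K -
      ‖D.state y‖ ^ 2| ≤ (2 ^ K : ℝ)⁻¹ := by
  have h := (D.path.isSubinterval_sample D.k (Nat.lt_succ_iff.1 D.k.isLt)
    (circuitFun D.circuit.reverse y)).abs_card_sub_le (2 ^ K)
  rw [← card_filter_ofBits K] at h
  simp only [circuitFun_eq_iff, D.state_apply]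
  have h2 : (0 : ℝ) < 2 ^ K := by positivity
  rw [div_sub' h2.ne', abs_div, abs_of_pos h2, div_le_iff₀ h2, inv_mul_cancel₀ h2.ne', mul_comm]
  exact_mod_cast h

theorem samplesPolyTime_schur (q : Polynomial ℕ) :
    SamplesPolyTime (ι := SchurData q) (fun D => D.n) (fun D => D.desc) (fun D => D.state) := by
  refine ⟨sampleProg,
    (.C bitsInitProg.costFactor + ((.X + 1) * .C (bitsBody.costFactor + 2) +
      (.C spinInitProg.costFactor + ((.X + 1) * .C (spinBody.costFactor + 2) +
      (.C sampleInitProg.costFactor + ((.X + 1) * .C (sampleBody.costFactor + 2) +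
      (.C gatesBeginProg.costFactor + (q + 1) * .C (gateForwardBody.costFactor + 2)))))))) *
        (.X * .X + 3 * .X + 4 * .X + 3 * q + 6), .X, fun D p => ?_⟩
  have hK : (Polynomial.X : Polynomial ℕ).eval (D.n + p) = D.n + p := Polynomial.eval_X
  refine ⟨fun r => circuitFun D.circuit (D.path.sample D.k (Nat.ofBits r)
    (2 ^ (Polynomial.X : Polynomial ℕ).eval (D.n + p))), fun r => ?_, ?_⟩
  · obtain ⟨s, ⟨t, ht, he⟩, hs⟩ := runs_sampleProg D p hK r
    refine ⟨s, t, he, ht.trans ?_, hs⟩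
    have hg := D.length_le.trans (q.eval_le_eval_nat (Nat.le_add_right D.n p))
    have hn := Nat.le_add_right D.n p
    have hp := Nat.le_add_left p D.n
    simp only [Polynomial.eval_mul, Polynomial.eval_add, Polynomial.eval_X, Polynomial.eval_one,
      Polynomial.eval_ofNat, Polynomial.eval_C, sampleFactor, sampleBits, loopFactor]
    gcongr
  · have h := Finset.sum_le_sum fun (x : Fin D.n → Bool) (_ : x ∈ Finset.univ) =>
      D.abs_card_sub_le ((Polynomial.X : Polynomial ℕ).eval (D.n + p)) x
    refine (mul_le_mul_of_nonneg_left h (by norm_num)).trans ?_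
    rw [hK]
    -- Each of the `2^n` outcomes contributes an error of at most `2^(-(n + p))`; the factor 1/2 in
    -- the total variation distance is not needed.
    have h2 : (2 : ℝ) ^ D.n * (2 ^ (D.n + p))⁻¹ = (2 ^ p)⁻¹ := by
      rw [pow_add, mul_inv, ← mul_assoc, mul_inv_cancel₀ (by positivity), one_mul]
    have h3 : (0 : ℝ) ≤ (2 ^ p)⁻¹ := by positivity
    simp only [Finset.sum_const, Finset.card_univ, Fintype.card_pi, Fintype.card_bool,
      Finset.prod_const, Fintype.card_fin, nsmul_eq_mul, Nat.cast_pow, Nat.cast_ofNat, h2]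
    linarith

theorem lemma1 :
    (∀ q : Polynomial ℕ,
      ComputationallyTractable (ι := SchurData q)
        (fun D => D.n) (fun D => D.desc) (fun D => D.state)) ∧
    (∀ (n a : ℕ) (P : SpinPath n a) (k : Fin (a + 1)) (C : List (Toffoli n)),
      Function.LeftInverse (circuitFun C.reverse) (circuitFun C) ∧
      Function.RightInverse (circuitFun C.reverse) (circuitFun C) ∧
      (∀ y : Fin n → Bool,
        (circuitOp C).mulVec (P.basisState k) y = P.basisState k (circuitFun C.reverse y)) ∧
      (∀ y : Fin n → Bool,
        ‖(circuitOp C).mulVec (P.basisState k) y‖ ^ 2 =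
          ∑ x ∈ Finset.univ.filter (fun x => circuitFun C x = y), ‖P.basisState k x‖ ^ 2)) := by
  refine ⟨fun q => ⟨polySizeDescriptions_schur q, amplitudesPolyTime_schur q,
    samplesPolyTime_schur q⟩, fun n a P k C => ⟨circuitFun_reverse_circuitFun C,
    circuitFun_circuitFun_reverse C, circuitOp_mulVec C _, fun y => ?_⟩⟩
  rw [circuitOp_mulVec, sum_filter_circuitFun C (fun x => ‖P.basisState k x‖ ^ 2)]
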